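/- Let $d\ge 1$ and let $\mathbb B_d$ be the open unit ball of $\mathbb C^d$. A unitarily invariant kernel on $\mathbb B_d$ is a function $k(z,w)=\sum_{n\ge 0}a_n^{(k)}\langle z,w\rangle^n$, convergent and non-vanishing on $\mathbb B_d\times\mathbb B_d$, with $a_n^{(k)}>0$ and $a_0^{(k)}=1$. Let $b_n^{(k)}$ ($n\ge1$) be given by $\sum_{n\ge1}b_n^{(k)}t^n=1-1/\sum_{n\ge0}a_n^{(k)}t^n$, and for a multi-index $\alpha\in\mathbb Z_+^d$ put $a_\alpha^{(k)}=a_{|\alpha|}^{(k)}\frac{|\alpha|!}{\alpha!}$ and, if $\alpha\neq0$, $b_\alpha^{(k)}=b_{|\alpha|}^{(k)}\frac{|\alpha|!}{\alpha!}$. For a Hilbert space $\mathcal E$ let $H_k\otimes\mathcal E$ be the Hilbert space of functions $f(z)=\sum_\alpha c_\alpha z^\alpha$ on $\mathbb B_d$, $c_\alpha\in\mathcal E$, with $\|f\|^2=\sum_\alpha\|c_\alpha\|^2/a_\alpha^{(k)}<\infty$; thus $H_k=H_k\otimes\mathbb C$ is the reproducing kernel Hilbert space of $k$. Series over multi-indices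 are understood as limits of the partial sums over $|\alpha|\le N$, $N\to\infty$. A commuting $d$-tuple $T=(T_1,\dots,T_d)$ of bounded operators on a complex Hilbert space $\mathcal H$ is a $1/k$-contraction if $\sum_{\alpha\ne0}b_\alpha^{(k)}T^\alpha(T^\alpha)^*$ converges in the strong operator topology to a contraction. Then $\Delta_T$ denotes the positive square root of $I-\sum_{\alpha\ne0}b_\alpha^{(k)}T^\alpha(T^\alpha)^*$, and $T$ is called pure if $\sum_\alpha a_\alpha^{(k)}T^\alpha\Delta_T^2(T^\alpha)^*$ converges strongly to $I$. In this case $V_T:\mathcal H\to H_k\otimes\overline{\mathrm{Ran}}\,\Delta_T$, $V_Th=\sum_\alpha a_\alpha^{(k)}z^\alpha\otimes\Delta_T(T^\alpha)^*h$, is an isometry. The kernel $k$ is admissible if multiplication by each coordinate function $z_i$ is a bounded operator $M_{z_i}^{(k)}$ on $H_k$ and $(M_{z_1}^{(k)},\dots,M_{z_d}^{(k)})$ is a $1/k$-contraction. Let $k$ and $l$ be admissible kernels on $\mathbb B_d$ and let $T$ be a pure $1/k$-contraction. The subspace $\mathrm{Ker}\,V_T^*$ is invariant under the operators $M_{z_i}^{(k)}\otimes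 I$; let $B_T=\big((M_{z_1}^{(k)}\otimes I)|_{\mathrm{Ker}V_T^*},\dots,(M_{z_d}^{(k)}\otimes I)|_{\mathrm{Ker}V_T^*}\big)$. We say that $T$ admits a characteristic function through $l$ if there are a Hilbert space $\mathcal E$ and an analytic function $\theta:\mathbb B_d\to\mathcal B(\mathcal E,\overline{\mathrm{Ran}}\,\Delta_T)$ such that multiplication by $\theta$ is a bounded operator $M_\theta:H_l\otimes\mathcal E\to H_k\otimes\overline{\mathrm{Ran}}\,\Delta_T$ and $I-V_TV_T^*=M_\theta M_\theta^*$. Then $T$ admits a characteristic function through $l$ if and only if $B_T$ is a $1/l$-contraction. -/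

import Mathlib

open Filter Topology

noncomputable section

/-- The open unit ball of `ℂ^d`. -/
abbrev cball (d : ℕ) : Set (EuclideanSpace ℂ (Fin d)) := Metric.ball 0 1

/-- The monomial `z^α = z₁^{α₁} ⋯ z_d^{α_d}`. -/
def monom {d : ℕ} (α : Fin d → ℕ) (z : EuclideanSpace ℂ (Fin d)) : ℂ := ∏ i, z i ^ α i

/-- The finite set of multi-indices `α` with `|α| ≤ N`. -/
def degLE (d N : ℕ) : Finset (Fin d → ℕ) := {α ∈ Finset.Iic (fun _ => N) | ∑ i, α i ≤ N}

/-- A unitarily invariant kernel `k(z, w) = ∑ₙ aₙ ⟨z, w⟩ⁿ` on the open unit ball of `ℂ^d`, with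
`aₙ > 0`, `a₀ = 1`, and without zeros. Here `⟨z, w⟩ = ∑ zᵢ conj(wᵢ)`, which is `inner ℂ w z`. -/
structure UnitarilyInvariantKernel (d : ℕ) where
  a : ℕ → ℝ
  a_pos : ∀ n, 0 < a n
  a_zero : a 0 = 1
  summable : ∀ z ∈ cball d, ∀ w ∈ cball d, Summable fun n => (a n : ℂ) * inner ℂ w z ^ n
  ne_zero : ∀ z ∈ cball d, ∀ w ∈ cball d, ∑' n, (a n : ℂ) * inner ℂ w z ^ n ≠ 0

theorem mem_degLE {d N : ℕ} {α : Fin d → ℕ} : α ∈ degLE d N ↔ ∑ i, α i ≤ N := by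
  simp only [degLE, Finset.mem_filter, Finset.mem_Iic, and_iff_right_iff_imp]
  intro h i
  exact (Finset.single_le_sum (fun j _ => Nat.zero_le (α j)) (Finset.mem_univ i)).trans h

theorem tendsto_degLE (d : ℕ) : Tendsto (degLE d) atTop atTop := by
  refine tendsto_atTop_finset_of_monotone ?_ fun α => ⟨∑ i, α i, mem_degLE.2 le_rfl⟩
  intro M N h α hα
  exact mem_degLE.2 ((mem_degLE.1 hα).trans h)

theorem sum_degLE {R : Type*} [CommRing R] {d : ℕ} (F : ℕ → R) (x : Fin d → R) (N : ℕ) :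
    ∑ α ∈ degLE d N, F (∑ i, α i) * (Nat.multinomial Finset.univ α : R) * ∏ i, x i ^ α i =
      ∑ n ∈ Finset.range (N + 1), F n * (∑ i, x i) ^ n := by
  rw [← Finset.sum_fiberwise_of_maps_to (s := degLE d N) (t := Finset.range (N + 1))
    (g := fun α => ∑ i, α i) (fun α hα => by simpa [Nat.lt_succ_iff] using mem_degLE.1 hα)]
  refine Finset.sum_congr rfl fun n hn => ?_
  rw [Finset.sum_pow_eq_sum_piAntidiag, Finset.mul_sum]
  refine Finset.sum_congr ?_ fun α hα => ?_
  · ext α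
    simp only [Finset.mem_filter, mem_degLE, Finset.mem_piAntidiag, Finset.mem_univ, implies_true,
      and_true]
    constructor
    · exact fun h => h.2
    · intro h
      have := Finset.mem_range.1 hn
      exact ⟨h ▸ Nat.lt_succ_iff.1 this, h⟩
  · have : ∑ i, α i = n := by simpa using (Finset.mem_piAntidiag.1 hα).1
    rw [this, mul_assoc]

namespace UnitarilyInvariantKernel

variable {d : ℕ} (k : UnitarilyInvariantKernel d)

/-- The kernel as a function of two variables. -/
def toFun (z w : EuclideanSpace ℂ (Fin d)) : ℂ := ∑' n, (k.a n : ℂ) * inner ℂ w z ^ n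

/-- The coefficients `a_α = a_{|α|} |α|! / α!`. -/
def aM (α : Fin d → ℕ) : ℝ := k.a (∑ i, α i) * Nat.multinomial Finset.univ α

/-- The coefficients `bₙ` (`n ≥ 1`) of `∑_{n ≥ 1} bₙ tⁿ = 1 - 1 / ∑_{n ≥ 0} aₙ tⁿ`. -/
def b (n : ℕ) : ℝ := PowerSeries.coeff n (1 - (PowerSeries.mk k.a)⁻¹)

/-- The coefficients `b_α = b_{|α|} |α|! / α!`, `α ≠ 0`. -/
def bM (α : Fin d → ℕ) : ℝ := k.b (∑ i, α i) * Nat.multinomial Finset.univ α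

theorem aM_pos (α : Fin d → ℕ) : 0 < k.aM α :=
  mul_pos (k.a_pos _) (by exact_mod_cast Nat.multinomial_pos _ _)

theorem summable_aM {z : EuclideanSpace ℂ (Fin d)} (hz : z ∈ cball d) :
    Summable fun α => k.aM α * ‖monom α z‖ ^ 2 := by
  have hs : Summable fun n => k.a n * (‖z‖ ^ 2) ^ n := by
    have := (k.summable z hz z hz)
    rw [← Complex.summable_ofReal]
    refine this.congr fun n => ?_
    rw [inner_self_eq_norm_sq_to_K]
    push_cast
    rfl
  have hterm : ∀ α, 0 ≤ k.aM α * ‖monom α z‖ ^ 2 := fun α =>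
    mul_nonneg (k.aM_pos α).le (by positivity)
  refine summable_of_sum_le hterm (c := ∑' n, k.a n * (‖z‖ ^ 2) ^ n) fun F => ?_
  obtain ⟨N, hN⟩ := ((tendsto_degLE d).eventually (eventually_ge_atTop F)).exists
  refine (Finset.sum_le_sum_of_subset_of_nonneg hN fun α _ _ => hterm α).trans ?_
  have := sum_degLE k.a (fun i => ‖z i‖ ^ 2) N
  rw [← EuclideanSpace.norm_sq_eq] at this
  calc _ = _ := Finset.sum_congr rfl fun α _ => by
          rw [monom, norm_prod, ← Finset.prod_pow]
          simp only [norm_pow, ← pow_mul, aM]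
          simp only [mul_comm]
    _ = _ := this
    _ ≤ _ := hs.sum_le_tsum _ fun n _ => mul_nonneg (k.a_pos n).le (by positivity)

/-- The expansion `k(z, w) = ∑_α a_α z^α conj(w^α)`. -/
theorem hasSum_aM {z w : EuclideanSpace ℂ (Fin d)} (hz : z ∈ cball d) (hw : w ∈ cball d) :
    HasSum (fun α => (k.aM α : ℂ) * monom α z * star (monom α w)) (k.toFun z w) := by
  have hs : Summable fun α => (k.aM α : ℂ) * monom α z * star (monom α w) := by
    refine .of_norm_bounded ((k.summable_aM hz).add (k.summable_aM hw)) fun α => ?_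
    rw [norm_mul, norm_mul, norm_star, Complex.norm_of_nonneg (k.aM_pos α).le, ← mul_add,
      mul_assoc]
    refine mul_le_mul_of_nonneg_left ?_ (k.aM_pos α).le
    nlinarith [sq_nonneg (‖monom α z‖ - ‖monom α w‖), sq_nonneg ‖monom α z‖,
      sq_nonneg ‖monom α w‖]
  have h1 := hs.hasSum.comp (tendsto_degLE d)
  have h2 := (k.summable z hz w hw).hasSum.tendsto_sum_nat.comp (tendsto_add_atTop_nat 1)
  have h3 : (fun N => ∑ α ∈ degLE d N, (k.aM α : ℂ) * monom α z * star (monom α w)) =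
      (fun N => ∑ n ∈ Finset.range (N + 1), (k.a n : ℂ) * inner ℂ w z ^ n) := by
    funext N
    have := sum_degLE (fun n => (k.a n : ℂ)) (fun i => z i * star (w i)) N
    rw [PiLp.inner_apply]
    simp only [RCLike.inner_apply]
    refine Eq.trans (Finset.sum_congr rfl fun α _ => ?_) this
    simp only [monom, mul_pow, Finset.prod_mul_distrib, aM, star_prod, star_pow]
    push_cast
    ring
  have h4 := tendsto_nhds_unique h1 (h2.congr fun N => (congrFun h3 N).symm)
  unfold toFun
  rw [← h4]
  exact hs.hasSum


section space

variable (E : Type*) [NormedAddCommGroup E]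

/-- The space `H_k(E) = H_k ⊗ E`. An element is given by its coordinates `(f_α)` with respect to
the orthonormal system `√a_α z^α` of `H_k`, so that it is the function
`f(z) = ∑_α √a_α z^α f_α` with Taylor coefficients `c_α = √a_α f_α` and norm
`‖f‖² = ∑_α ‖f_α‖² = ∑_α ‖c_α‖² / a_α`. The coercion to functions is the `RKHS` instance below. -/
def HSpace (_k : UnitarilyInvariantKernel d) (E : Type*) [NormedAddCommGroup E] : Type _ :=
  lp (fun _ : Fin d → ℕ => E) 2

instance : NormedAddCommGroup (HSpace k E) :=
  inferInstanceAs (NormedAddCommGroup (lp (fun _ : Fin d → ℕ => E) 2))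

instance [InnerProductSpace ℂ E] : InnerProductSpace ℂ (HSpace k E) :=
  inferInstanceAs (InnerProductSpace ℂ (lp (fun _ : Fin d → ℕ => E) 2))

instance [CompleteSpace E] : CompleteSpace (HSpace k E) :=
  inferInstanceAs (CompleteSpace (lp (fun _ : Fin d → ℕ => E) 2))

variable {E}

/-- The element of `H_k(E)` with the given square summable coordinates. -/
def ofCoord (c : (Fin d → ℕ) → E) (hc : Memℓp c 2) : HSpace k E :=
  (⟨c, hc⟩ : lp (fun _ : Fin d → ℕ => E) 2)

variable {k}

/-- The underlying square summable family. -/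
def toL2 (f : HSpace k E) : lp (fun _ : Fin d → ℕ => E) 2 := f

/-- The coordinates of an element of `H_k(E)` with respect to `√a_α z^α`. -/
def coord (f : HSpace k E) : (Fin d → ℕ) → E := (toL2 f : (Fin d → ℕ) → E)

theorem coord_add (f g : HSpace k E) (α) : coord (f + g) α = coord f α + coord g α := rfl

theorem coord_smul [InnerProductSpace ℂ E] (c : ℂ) (f : HSpace k E) (α) : coord (c • f) α = c • coord f α := rfl

theorem coord_ofCoord (c : (Fin d → ℕ) → E) (hc : Memℓp c 2) : coord (ofCoord k c hc) = c := rfl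

theorem coord_ext {f g : HSpace k E} (h : ∀ α, coord f α = coord g α) : f = g :=
  lp.ext (funext h)

theorem memℓp_coord (f : HSpace k E) : Memℓp (coord f) 2 :=
  lp.memℓp (toL2 f)

theorem hasSum_norm_coord (f : HSpace k E) : HasSum (fun α => ‖coord f α‖ ^ 2) (‖f‖ ^ 2) := by
  have := lp.hasSum_norm (p := 2) (by norm_num) (toL2 f)
  simpa using! this

theorem hasSum_inner_coord [InnerProductSpace ℂ E] (f g : HSpace k E) :
    HasSum (fun α => inner ℂ (coord f α) (coord g α)) (inner ℂ f g) :=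
  lp.hasSum_inner (toL2 f) (toL2 g)

variable (k)

/-- The value at `z` of the orthonormal basis element `√a_α z^α`. -/
def basisVal (z : EuclideanSpace ℂ (Fin d)) (α : Fin d → ℕ) : ℂ := (√(k.aM α) : ℝ) * monom α z

theorem norm_basisVal_sq (z : EuclideanSpace ℂ (Fin d)) (α : Fin d → ℕ) :
    ‖k.basisVal z α‖ ^ 2 = k.aM α * ‖monom α z‖ ^ 2 := by
  rw [basisVal, norm_mul, mul_pow, Complex.norm_of_nonneg (Real.sqrt_nonneg _),
    Real.sq_sqrt (k.aM_pos α).le]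

theorem memℓp_basisVal {z : EuclideanSpace ℂ (Fin d)} (hz : z ∈ cball d) :
    Memℓp (k.basisVal z) 2 := by
  refine memℓp_gen ?_
  simpa [norm_basisVal_sq] using k.summable_aM hz

theorem summable_norm_eval [InnerProductSpace ℂ E] {z : EuclideanSpace ℂ (Fin d)} (hz : z ∈ cball d) (f : HSpace k E) :
    (Summable fun α => ‖k.basisVal z α • coord f α‖) ∧
      ∑' α, ‖k.basisVal z α • coord f α‖ ≤ ‖ofCoord k _ (k.memℓp_basisVal hz)‖ * ‖f‖ := by
  have hpq : (2 : ENNReal).toReal.HolderConjugate (2 : ENNReal).toReal := by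
    rw [Real.holderConjugate_iff]; norm_num
  have hf : HasSum (fun α => ‖coord f α‖ ^ (2 : ENNReal).toReal) (‖f‖ ^ (2 : ENNReal).toReal) := by
    simpa using hasSum_norm_coord f
  have hg : HasSum (fun α => ‖k.basisVal z α‖ ^ (2 : ENNReal).toReal)
      (‖ofCoord k _ (k.memℓp_basisVal hz)‖ ^ (2 : ENNReal).toReal) := by
    simpa using! hasSum_norm_coord (ofCoord k _ (k.memℓp_basisVal hz))
  obtain ⟨C, -, hC', hC⟩ := Real.inner_le_Lp_mul_Lq_hasSum_of_nonneg hpq (norm_nonneg _)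
    (norm_nonneg _) (fun α => norm_nonneg _) (fun α => norm_nonneg _) hg hf
  simp only [norm_smul]
  exact ⟨hC.summable, hC.tsum_eq ▸ hC'⟩

variable [InnerProductSpace ℂ E] [CompleteSpace E]

/-- Evaluation of `f` in `H_k(E)` at a point of the ball: `f(z) = ∑_α √a_α z^α f_α`. -/
def evalCLM (z : cball d) : HSpace k E →L[ℂ] E :=
  LinearMap.mkContinuous
    { toFun := fun f => ∑' α, k.basisVal z α • coord f α
      map_add' := fun f g => by
        simp only [coord_add, smul_add]
        exact (k.summable_norm_eval z.2 f).1.of_norm.tsum_add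
          (k.summable_norm_eval z.2 g).1.of_norm
      map_smul' := fun c f => by
        simp only [coord_smul, smul_comm _ c, RingHom.id_apply]
        exact (k.summable_norm_eval z.2 f).1.of_norm.tsum_const_smul c }
    ‖ofCoord k _ (k.memℓp_basisVal z.2)‖ fun f =>
      (norm_tsum_le_tsum_norm (k.summable_norm_eval z.2 f).1).trans
        (k.summable_norm_eval z.2 f).2

theorem hasSum_evalCLM (z : cball d) (f : HSpace k E) :
    HasSum (fun α => k.basisVal z α • coord f α) (k.evalCLM z f) :=
  (k.summable_norm_eval z.2 f).1.of_norm.hasSum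

end space

theorem eq_zero_of_hasSum_monom_aux (μ : MeasureTheory.Measure (UnitAddTorus (Fin d)))
    [MeasureTheory.IsFiniteMeasure μ]
    (hμ : Orthonormal ℂ fun n : Fin d → ℤ =>
      ContinuousMap.toLp (E := ℂ) 2 μ ℂ (UnitAddTorus.mFourier n)) (c : (Fin d → ℕ) → ℂ)
    (h : ∀ z ∈ cball d, (Summable fun α => ‖c α * monom α z‖) ∧
      HasSum (fun α => c α * monom α z) 0) : c = 0 := by
  obtain ⟨r, hr0, hr⟩ : ∃ r : ℝ, 0 < r ∧ d * r ^ 2 < 1 := by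
    refine ⟨1 / (d + 1), by positivity, ?_⟩
    have : (0 : ℝ) ≤ d := Nat.cast_nonneg d
    rw [div_pow, one_pow, mul_one_div, div_lt_one (by positivity)]
    nlinarith
  let Z : UnitAddTorus (Fin d) → EuclideanSpace ℂ (Fin d) := fun x =>
    WithLp.toLp 2 fun i => (r : ℂ) * fourier 1 (x i)
  have hZ : ∀ x, Z x ∈ cball d := fun x => by
    rw [mem_ball_zero_iff, ← sq_lt_one_iff₀ (norm_nonneg _), EuclideanSpace.norm_sq_eq]
    have h1 : ∀ i, ‖(Z x) i‖ ^ 2 = r ^ 2 := fun i => by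
      change ‖(r : ℂ) * fourier 1 (x i)‖ ^ 2 = r ^ 2
      rw [norm_mul, fourier_apply, Circle.norm_coe, mul_one, Complex.norm_of_nonneg hr0.le]
    simpa [h1] using hr
  have hmon : ∀ α x, monom α (Z x) =
      (r : ℂ) ^ (∑ i, α i) * UnitAddTorus.mFourier (fun i => (α i : ℤ)) x := fun α x => by
    have h1 : ∀ (n : ℕ) (y : UnitAddCircle),
        (fourier (n : ℤ) y : ℂ) = (fourier 1 y : ℂ) ^ n := by
      intro n y
      induction n with
      | zero => simp
      | succ n ih => rw [Nat.cast_succ, fourier_add, ih, pow_succ]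
    simp only [monom, Z, UnitAddTorus.mFourier, ContinuousMap.coe_mk, h1, mul_pow,
      Finset.prod_mul_distrib, Finset.prod_pow_eq_pow_sum]
  let g : (Fin d → ℕ) → C(UnitAddTorus (Fin d), ℂ) := fun α =>
    (c α * (r : ℂ) ^ (∑ i, α i)) • UnitAddTorus.mFourier (fun i => (α i : ℤ))
  have hgval : ∀ α x, g α x = c α * monom α (Z x) := fun α x => by
    rw [hmon]; simp [g, mul_assoc]
  have hgs : Summable g := by
    refine .of_norm ?_
    refine (h (Z 0) (hZ 0)).1.congr fun α => ?_
    rw [hmon, norm_smul, UnitAddTorus.mFourier_norm, norm_mul, norm_mul, norm_mul]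
    simp [UnitAddTorus.mFourier]
  have hg : HasSum g 0 := by
    convert hgs.hasSum
    ext x
    have h1 := ContinuousMap.hasSum_apply hgs.hasSum x
    simp only [hgval] at h1
    exact (h _ (hZ x)).2.unique h1
  funext β
  have h2 := (innerSL ℂ (ContinuousMap.toLp (E := ℂ) 2 μ ℂ
    (UnitAddTorus.mFourier fun i => (β i : ℤ)))).hasSum
      ((ContinuousMap.toLp (E := ℂ) 2 μ ℂ).hasSum hg)
  have h3 : ∀ α, innerSL ℂ (ContinuousMap.toLp (E := ℂ) 2 μ ℂ
      (UnitAddTorus.mFourier fun i => (β i : ℤ))) (ContinuousMap.toLp (E := ℂ) 2 μ ℂ (g α)) =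
      if α = β then c β * (r : ℂ) ^ (∑ i, β i) else 0 := fun α => by
    have := orthonormal_iff_ite.1 hμ
      (fun i => (β i : ℤ)) (fun i => (α i : ℤ))
    rw [innerSL_apply_apply, map_smul, inner_smul_right, this]
    by_cases hab : α = β
    · simp [hab]
    · rw [if_neg hab, if_neg, mul_zero]
      intro hh
      exact hab (funext fun i => by exact_mod_cast (congrFun hh i).symm)
  simp only [h3, map_zero] at h2
  have h4 := h2.unique (hasSum_ite_eq β _)
  have hr' : (r : ℂ) ≠ 0 := by exact_mod_cast hr0.ne'
  simpa [hr'] using h4.symm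

/-- Uniqueness of power series coefficients on the ball. -/
theorem eq_zero_of_hasSum_monom (c : (Fin d → ℕ) → ℂ)
    (h : ∀ z ∈ cball d, (Summable fun α => ‖c α * monom α z‖) ∧
      HasSum (fun α => c α * monom α z) 0) : c = 0 :=
  eq_zero_of_hasSum_monom_aux (MeasureTheory.Measure.pi fun _ => AddCircle.haarAddCircle)
    UnitAddTorus.orthonormal_mFourier c h

section space

variable {E : Type*} [NormedAddCommGroup E] [InnerProductSpace ℂ E] [CompleteSpace E]

/-- `H_k(E)` as a Hilbert space of `E`-valued functions on the ball. -/
instance : RKHS ℂ (HSpace k E) (cball d) E where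
  coeCLM := ContinuousLinearMap.pi fun z => k.evalCLM z
  coeCLM_injective := by
    refine (injective_iff_map_eq_zero _).2 fun f hf => coord_ext fun α => ?_
    refine ext_inner_left ℂ fun v => ?_
    have hc := eq_zero_of_hasSum_monom
      (fun α => (√(k.aM α) : ℝ) * inner ℂ v (coord f α)) fun z hz => by
        have h1 := (innerSL ℂ v).hasSum (k.hasSum_evalCLM ⟨z, hz⟩ f)
        have h2 : k.evalCLM ⟨z, hz⟩ f = 0 := congrFun hf ⟨z, hz⟩
        rw [h2, map_zero] at h1
        have h3 : (fun α => (√(k.aM α) : ℝ) * inner ℂ v (coord f α) * monom α z) =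
            fun α => innerSL ℂ v (k.basisVal z α • coord f α) := by
          funext α
          rw [innerSL_apply_apply, inner_smul_right, basisVal]
          ring
        have h4 : (fun α => ‖(√(k.aM α) : ℝ) * inner ℂ v (coord f α) * monom α z‖) =
            fun α => ‖innerSL ℂ v (k.basisVal z α • coord f α)‖ := by
          funext α
          rw [← congrFun h3 α]
        rw [h4, h3]
        exact ⟨((k.summable_norm_eval hz f).1.mul_left ‖innerSL ℂ v‖).of_nonneg_of_le
          (fun α => norm_nonneg _) (fun α => (innerSL ℂ v).le_opNorm _), h1⟩
    have := congrFun hc α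
    have ha : (√(k.aM α) : ℂ) ≠ 0 := by
      exact_mod_cast (Real.sqrt_pos.2 (k.aM_pos α)).ne'
    simp only [Pi.zero_apply, mul_eq_zero, ha, false_or] at this
    rw [this]
    exact (inner_zero_right v).symm

theorem hasSum_apply (f : HSpace k E) (z : cball d) :
    HasSum (fun α => k.basisVal z α • coord f α) (f z) :=
  k.hasSum_evalCLM z f

/-- The reproducing kernel of `H_k(E)` is `k(z, w) I_E`. -/
theorem kernel_HSpace (z w : cball d) :
    RKHS.kernel (HSpace k E) z w = k.toFun z w • ContinuousLinearMap.id ℂ E := by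
  ext v
  have hm : Memℓp (fun α => star (k.basisVal w α) • v) 2 := by
    refine memℓp_gen ?_
    have := (k.summable_aM w.2).mul_right (‖v‖ ^ 2)
    simpa [norm_smul, mul_pow, norm_basisVal_sq] using this
  have h1 : RKHS.kerFun (HSpace k E) w v = ofCoord k _ hm := by
    refine ext_inner_right ℂ fun (f : HSpace k E) => ?_
    rw [RKHS.kerFun_inner]
    refine HasSum.unique ?_ (hasSum_inner_coord _ f)
    have := (innerSL ℂ v).hasSum (k.hasSum_apply f w)
    convert! this using 2 with α
    rw [coord_ofCoord, innerSL_apply_apply, inner_smul_left, inner_smul_right]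
    simp
  rw [← RKHS.kerFun_apply, h1]
  refine (k.hasSum_apply _ z).unique ?_
  have := (k.hasSum_aM z.2 w.2).smul_const v
  convert! this using 2 with α
  rw [coord_ofCoord, smul_smul]
  congr 1
  simp only [basisVal, star_mul', RCLike.star_def, Complex.conj_ofReal]
  have : ((√(k.aM α) : ℝ) : ℂ) * (√(k.aM α) : ℝ) = k.aM α := by
    rw [← Complex.ofReal_mul, Real.mul_self_sqrt (k.aM_pos α).le]
  linear_combination (monom α z.1 * (starRingEnd ℂ) (monom α w.1)) * this

end space

section shift

variable {E : Type*} [NormedAddCommGroup E]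

/-- The function `√a_α z^α v` of `H_k(E)`. -/
def basisFun (α : Fin d → ℕ) (v : E) : HSpace k E :=
  lp.single (E := fun _ : Fin d → ℕ => E) 2 α v

theorem coord_basisFun (α : Fin d → ℕ) (v : E) : coord (k.basisFun α v) = Pi.single α v :=
  lp.coeFn_single (E := fun _ : Fin d → ℕ => E) 2 α v

theorem norm_basisFun (α : Fin d → ℕ) (v : E) : ‖k.basisFun α v‖ = ‖v‖ :=
  lp.norm_single (E := fun _ : Fin d → ℕ => E) (p := 2) (by norm_num) α v

theorem hasSum_basisFun (f : HSpace k E) : HasSum (fun α => k.basisFun α (coord f α)) f :=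
  lp.hasSum_single (by norm_num) (toL2 f)

variable [InnerProductSpace ℂ E] [CompleteSpace E]

theorem basisFun_apply (α : Fin d → ℕ) (v : E) (z : cball d) :
    k.basisFun α v z = k.basisVal z α • v := by
  refine (k.hasSum_apply _ z).unique ?_
  have := hasSum_ite_eq α (k.basisVal z α • v)
  convert! this using 2 with β
  rw [coord_basisFun]
  by_cases h : β = α
  · subst h; simp
  · simp [h]

/-- The weight of the shift `M_{z_i}` on the basis `√a_α z^α`. -/
def shiftWeight (i : Fin d) (α : Fin d → ℕ) : ℝ := √(k.aM α) / √(k.aM (α + Pi.single i 1))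

theorem shiftWeight_mul (i : Fin d) (α : Fin d → ℕ) :
    k.shiftWeight i α * √(k.aM (α + Pi.single i 1)) = √(k.aM α) :=
  div_mul_cancel₀ _ (Real.sqrt_pos.2 (k.aM_pos _)).ne'

theorem shiftWeight_nonneg (i : Fin d) (α : Fin d → ℕ) : 0 ≤ k.shiftWeight i α :=
  div_nonneg (Real.sqrt_nonneg _) (Real.sqrt_nonneg _)

theorem monom_add_single (i : Fin d) (α : Fin d → ℕ) (z : EuclideanSpace ℂ (Fin d)) :
    monom (α + Pi.single i 1) z = z i * monom α z := by
  simp only [monom, Pi.add_apply, pow_add, Finset.prod_mul_distrib]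
  rw [mul_comm]
  congr 1
  rw [Finset.prod_eq_single i (fun j _ hj => by simp [hj]) (by simp)]
  simp

theorem shiftWeight_basisVal (i : Fin d) (α : Fin d → ℕ) (z : EuclideanSpace ℂ (Fin d)) :
    (k.shiftWeight i α : ℂ) * k.basisVal z (α + Pi.single i 1) = z i * k.basisVal z α := by
  rw [basisVal, basisVal, monom_add_single, ← k.shiftWeight_mul i α]
  push_cast
  ring

theorem coordMul_basisFun_of (i : Fin d) (A : HSpace k E →L[ℂ] HSpace k E)
    (hA : ∀ (f : HSpace k E) (z : cball d), A f z = z.1 i • f z) (α : Fin d → ℕ) (v : E) :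
    A (k.basisFun α v) = (k.shiftWeight i α : ℂ) • k.basisFun (α + Pi.single i 1) v := by
  refine RKHS.ext fun z => ?_
  rw [hA, RKHS.coe_smul, Pi.smul_apply, basisFun_apply, basisFun_apply, smul_smul, smul_smul,
    shiftWeight_basisVal]

variable {k} in
/-- If `M_{z_i}` is bounded on `H_k`, then it is bounded on `H_k(E)`. -/
theorem exists_coordMul {i : Fin d}
    (h : ∃ A : HSpace k ℂ →L[ℂ] HSpace k ℂ, ∀ f (z : cball d), A f z = z.1 i • f z) :
    ∃ A : HSpace k E →L[ℂ] HSpace k E, ∀ f (z : cball d), A f z = z.1 i • f z := by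
  obtain ⟨A, hA⟩ := h
  have hw : ∀ α, k.shiftWeight i α ≤ ‖A‖ := fun α => by
    have := A.le_opNorm (k.basisFun α 1)
    rwa [k.coordMul_basisFun_of i A hA, norm_smul, norm_basisFun, norm_basisFun, norm_one, mul_one, mul_one,
      Complex.norm_of_nonneg (k.shiftWeight_nonneg i α)] at this
  have hinj : Function.Injective fun α : Fin d → ℕ => α + Pi.single i 1 :=
    add_left_injective _
  let S : HSpace k E → (Fin d → ℕ) → E := fun f =>
    Function.extend (fun α : Fin d → ℕ => α + Pi.single i 1)
      (fun α => (k.shiftWeight i α : ℂ) • coord f α) 0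
  have hS : ∀ (f : HSpace k E) α, S f (α + Pi.single i 1) = (k.shiftWeight i α : ℂ) • coord f α :=
    fun f α => hinj.extend_apply _ _ α
  have hS0 : ∀ (f : HSpace k E) β, β ∉ Set.range (fun α : Fin d → ℕ => α + Pi.single i 1) → S f β = 0 :=
    fun f β hβ => Function.extend_apply' _ _ _ hβ
  have hle : ∀ (f : HSpace k E) α, ‖(k.shiftWeight i α : ℂ) • coord f α‖ ^ 2 ≤ ‖A‖ ^ 2 * ‖coord f α‖ ^ 2 :=
    fun f α => by
      rw [norm_smul, mul_pow, Complex.norm_of_nonneg (k.shiftWeight_nonneg i α)]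
      gcongr
      · exact k.shiftWeight_nonneg i α
      · exact hw α
  have hsum : ∀ f : HSpace k E, Summable fun α => ‖(k.shiftWeight i α : ℂ) • coord f α‖ ^ 2 := fun f =>
    .of_nonneg_of_le (fun α => by positivity) (hle f) ((hasSum_norm_coord f).summable.mul_left _)
  have hext : ∀ f, HasSum (fun β => ‖S f β‖ ^ 2)
      (∑' α, ‖(k.shiftWeight i α : ℂ) • coord f α‖ ^ 2) := fun f => by
    refine (hinj.hasSum_iff (fun β hβ => by rw [hS0 f β hβ]; simp)).1 ?_
    simp only [Function.comp_def, hS]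
    exact (hsum f).hasSum
  have hmem : ∀ f, Memℓp (S f) 2 := fun f => memℓp_gen (by simpa using (hext f).summable)
  let L : HSpace k E →ₗ[ℂ] HSpace k E :=
    { toFun := fun f => ofCoord k (S f) (hmem f)
      map_add' := fun f g => coord_ext fun β => by
        rw [coord_add, coord_ofCoord, coord_ofCoord, coord_ofCoord]
        by_cases hβ : β ∈ Set.range (fun α : Fin d → ℕ => α + Pi.single i 1)
        · obtain ⟨α, rfl⟩ := hβ
          simp only [hS, coord_add, smul_add]
        · simp only [hS0 _ β hβ, add_zero]
      map_smul' := fun c f => coord_ext fun β => by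
        rw [RingHom.id_apply, coord_smul, coord_ofCoord, coord_ofCoord]
        by_cases hβ : β ∈ Set.range (fun α : Fin d → ℕ => α + Pi.single i 1)
        · obtain ⟨α, rfl⟩ := hβ
          simp only [hS, coord_smul, smul_comm c]
        · simp only [hS0 _ β hβ, smul_zero] }
  have hL : ∀ f, ‖L f‖ ≤ ‖A‖ * ‖f‖ := fun f => by
    refine le_of_sq_le_sq ?_ (by positivity)
    rw [mul_pow]
    have h1 : HasSum (fun β => ‖S f β‖ ^ 2) (‖L f‖ ^ 2) := hasSum_norm_coord (L f)
    rw [h1.unique (hext f)]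
    exact hasSum_le (hle f) (hsum f).hasSum ((hasSum_norm_coord f).mul_left _)
  refine ⟨L.mkContinuous ‖A‖ hL, fun f z => ?_⟩
  refine (k.hasSum_apply (L f) z).unique ?_
  refine (hinj.hasSum_iff (fun β hβ => ?_)).1 ?_
  · change k.basisVal z β • S f β = 0
    rw [hS0 f β hβ, smul_zero]
  · have := (k.hasSum_apply f z).const_smul (z.1 i)
    convert! this using 2 with α
    change k.basisVal z (α + Pi.single i 1) • S f (α + Pi.single i 1) = _
    rw [hS, smul_smul, smul_smul, ← shiftWeight_basisVal, mul_comm]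

end shift

end UnitarilyInvariantKernel

/-- The power `T^α = T₁^{α₁} ⋯ T_d^{α_d}` of a tuple. -/
def tuplePow {R : Type*} [Monoid R] {d : ℕ} (T : Fin d → R) (α : Fin d → ℕ) : R :=
  (List.ofFn fun i => T i ^ α i).prod

theorem tuplePow_add_single {R : Type*} [Monoid R] {d : ℕ} (T : Fin d → R)
    (hT : ∀ i j, Commute (T i) (T j)) (α : Fin d → ℕ) (i : Fin d) :
    tuplePow T (α + Pi.single i 1) = T i * tuplePow T α := by
  induction d with
  | zero => exact i.elim0
  | succ d ih =>
    simp only [tuplePow, List.ofFn_succ, List.prod_cons] at ih ⊢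
    refine Fin.cases ?_ (fun j => ?_) i
    · have h : ∀ m : Fin d, (Pi.single (0 : Fin (d + 1)) 1 : Fin (d + 1) → ℕ) m.succ = 0 :=
        fun m => Pi.single_eq_of_ne (Fin.succ_ne_zero m) _
      simp only [Pi.add_apply, Pi.single_eq_same, h, add_zero, pow_succ', mul_assoc]
    · have h0 : (Pi.single j.succ 1 : Fin (d + 1) → ℕ) 0 = 0 :=
        Pi.single_eq_of_ne (Fin.succ_ne_zero j).symm _
      have h : ∀ m : Fin d, (Pi.single j.succ 1 : Fin (d + 1) → ℕ) m.succ =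
          (Pi.single j 1 : Fin d → ℕ) m := fun m => by
        by_cases hm : m = j
        · subst hm; simp
        · rw [Pi.single_eq_of_ne hm, Pi.single_eq_of_ne (fun h => hm (Fin.succ_injective _ h))]
      have := ih (fun m => T m.succ) (fun a b => hT _ _) (fun m => α m.succ) j
      simp only [Pi.add_apply] at this
      simp only [Pi.add_apply, h0, h, add_zero]
      rw [this, ← mul_assoc, ← mul_assoc, ((hT 0 j.succ).pow_left (α 0)).eq]

universe u

namespace UnitarilyInvariantKernel

section operators

open ContinuousLinearMap

variable {d : ℕ} (k : UnitarilyInvariantKernel d)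
variable {H : Type u} [NormedAddCommGroup H] [InnerProductSpace ℂ H] [CompleteSpace H]
variable {T : Fin d → H →L[ℂ] H}

/-- `S` is the sum, in the strong operator topology, of the series
`∑_{α ≠ 0} b_α T^α (T^α)^*`, the partial sums being taken over `|α| ≤ N`. -/
def HasDefectSum (T : Fin d → H →L[ℂ] H) (S : H →L[ℂ] H) : Prop :=
  ∀ h : H, Tendsto (fun N : ℕ => ∑ α ∈ (degLE d N).erase 0,
    (k.bM α : ℂ) • tuplePow T α (adjoint (tuplePow T α) h)) atTop (𝓝 (S h))

/-- `T` is a `1/k`-contraction: a commuting tuple of bounded operators such that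
`∑_{α ≠ 0} b_α T^α (T^α)^*` converges in the strong operator topology to a contraction. -/
structure IsContraction (T : Fin d → H →L[ℂ] H) : Prop where
  commute : ∀ i j, Commute (T i) (T j)
  exists_sum : ∃ S : H →L[ℂ] H, ‖S‖ ≤ 1 ∧ k.HasDefectSum T S

variable {k}

/-- The defect operator `Δ_T`, the positive square root of `I - ∑_{α ≠ 0} b_α T^α (T^α)^*`. -/
def defect (hT : k.IsContraction T) : H →L[ℂ] H := CFC.sqrt (1 - hT.exists_sum.choose)

/-- The closure of the range of `Δ_T`. -/
def defectSpace (hT : k.IsContraction T) : Submodule ℂ H :=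
  (LinearMap.range (defect hT).toLinearMap).topologicalClosure

instance (hT : k.IsContraction T) : CompleteSpace (defectSpace hT) :=
  inferInstanceAs (CompleteSpace (LinearMap.range (defect hT).toLinearMap).topologicalClosure)

variable (k) in
/-- `T` is a pure `1/k`-contraction: `∑_α a_α T^α Δ_T² (T^α)^*` converges strongly to `I`. -/
structure IsPure (T : Fin d → H →L[ℂ] H) : Prop where
  isContraction : k.IsContraction T
  tendsto : ∀ h : H, Tendsto (fun N : ℕ => ∑ α ∈ degLE d N, (k.aM α : ℂ) •
    tuplePow T α ((defect isContraction ^ 2) (adjoint (tuplePow T α) h))) atTop (𝓝 h)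

/-- `Δ_T` as a map into the closure of its range. -/
def defectMap (hT : k.IsContraction T) : H →L[ℂ] defectSpace hT :=
  (defect hT).codRestrict (defectSpace hT) fun h =>
    Submodule.le_topologicalClosure _ ⟨h, rfl⟩

theorem adjoint_defect (hT : k.IsContraction T) : adjoint (defect hT) = defect hT :=
  (IsSelfAdjoint.of_nonneg (CFC.sqrt_nonneg (1 - hT.exists_sum.choose))).adjoint_eq

theorem hasSum_defectMap (hT : k.IsPure T) (h : H) :
    HasSum (fun α => k.aM α * ‖defectMap hT.isContraction (adjoint (tuplePow T α) h)‖ ^ 2)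
      (‖h‖ ^ 2) := by
  have h1 := ((innerSL ℂ h).continuous.tendsto h).comp (hT.tendsto h)
  have h2 := (Complex.continuous_re.tendsto _).comp h1
  have h3 : Tendsto (fun N : ℕ => ∑ α ∈ degLE d N,
      k.aM α * ‖defectMap hT.isContraction (adjoint (tuplePow T α) h)‖ ^ 2)
      atTop (𝓝 (‖h‖ ^ 2)) := by
    rw [innerSL_apply_apply, inner_self_eq_norm_sq_to_K] at h2
    have h4 : (((‖h‖ : ℝ) : ℂ) ^ 2).re = ‖h‖ ^ 2 := by
      rw [← Complex.ofReal_pow, Complex.ofReal_re]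
    rw [← h4]
    refine h2.congr fun N => ?_
    simp only [Function.comp_apply, map_sum, innerSL_apply_apply, inner_smul_right]
    rw [Complex.re_sum]
    refine Finset.sum_congr rfl fun α _ => ?_
    have h5 : ∀ x : H, (defect hT.isContraction ^ 2) x =
        defect hT.isContraction (defect hT.isContraction x) := fun x => by
      rw [pow_two]; rfl
    rw [Complex.re_ofReal_mul, ← adjoint_inner_left, h5,
      ← adjoint_inner_left (defect hT.isContraction), adjoint_defect]
    congr 1
    exact inner_self_eq_norm_sq (𝕜 := ℂ) _
  have hnn : ∀ α, 0 ≤ k.aM α * ‖defectMap hT.isContraction (adjoint (tuplePow T α) h)‖ ^ 2 :=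
    fun α => mul_nonneg (k.aM_pos α).le (by positivity)
  have hs : Summable fun α =>
      k.aM α * ‖defectMap hT.isContraction (adjoint (tuplePow T α) h)‖ ^ 2 := by
    refine summable_of_sum_le hnn (c := ‖h‖ ^ 2) fun F => ?_
    refine ge_of_tendsto h3 ?_
    filter_upwards [(tendsto_degLE d).eventually (eventually_ge_atTop F)] with N hN
    exact Finset.sum_le_sum_of_subset_of_nonneg hN fun α _ _ => hnn α
  have := hs.hasSum.comp (tendsto_degLE d)
  rw [← tendsto_nhds_unique this h3]
  exact hs.hasSum

/-- The coordinates of `∑_α a_α z^α ⊗ Δ_T (T^α)^* h` with respect to `√a_α z^α`. -/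
def modelCoord (hT : k.IsPure T) (h : H) (α : Fin d → ℕ) : defectSpace hT.isContraction :=
  ((√(k.aM α) : ℝ) : ℂ) • defectMap hT.isContraction (adjoint (tuplePow T α) h)

theorem hasSum_modelCoord (hT : k.IsPure T) (h : H) :
    HasSum (fun α => ‖modelCoord hT h α‖ ^ 2) (‖h‖ ^ 2) := by
  refine (hasSum_defectMap hT h).congr_fun ?_
  intro α
  rw [modelCoord, norm_smul, mul_pow, Complex.norm_of_nonneg (Real.sqrt_nonneg _),
    Real.sq_sqrt (k.aM_pos α).le]

/-- The isometry `V_T : H → H_k ⊗ ran(Δ_T)^-`, `V_T h = ∑_α a_α z^α ⊗ Δ_T (T^α)^* h`. -/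
def modelIsometry (hT : k.IsPure T) : H →ₗᵢ[ℂ] HSpace k (defectSpace hT.isContraction) where
  toFun h := ofCoord k (modelCoord hT h)
    (memℓp_gen (by simpa using (hasSum_modelCoord hT h).summable))
  map_add' f g := coord_ext fun α => by
    rw [coord_add]
    simp only [coord_ofCoord, modelCoord, map_add, smul_add]
  map_smul' c f := coord_ext fun α => by
    rw [coord_smul]
    simp only [coord_ofCoord, modelCoord, map_smul, RingHom.id_apply, smul_comm c]
  norm_map' h := by
    rw [← sq_eq_sq₀ (norm_nonneg _) (norm_nonneg _)]
    exact (hasSum_norm_coord _).unique (hasSum_modelCoord hT h)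

theorem hasSum_modelIsometry_apply (hT : k.IsPure T) (h : H) (z : cball d) :
    HasSum (fun α => ((k.aM α : ℂ) * monom α z) •
      defectMap hT.isContraction (adjoint (tuplePow T α) h)) (modelIsometry hT h z) := by
  convert! k.hasSum_apply (modelIsometry hT h) z using 2 with α
  change _ = k.basisVal z α • modelCoord hT h α
  rw [modelCoord, smul_smul, basisVal]
  congr 1
  have : ((√(k.aM α) : ℝ) : ℂ) * (√(k.aM α) : ℝ) = k.aM α := by
    rw [← Complex.ofReal_mul, Real.mul_self_sqrt (k.aM_pos α).le]
  linear_combination -(monom α z.1) * this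

variable (k) in
/-- The kernel `k` is admissible: the multiplication operators `M_{z_i}` are bounded on `H_k` and
form a `1/k`-contraction. -/
def Admissible : Prop :=
  ∃ M : Fin d → HSpace k ℂ →L[ℂ] HSpace k ℂ,
    (∀ i f (z : cball d), M i f z = z.1 i • f z) ∧ k.IsContraction M

theorem Admissible.exists_coordMul (hk : k.Admissible) (E : Type*) [NormedAddCommGroup E]
    [InnerProductSpace ℂ E] [CompleteSpace E] (i : Fin d) :
    ∃ A : HSpace k E →L[ℂ] HSpace k E, ∀ f (z : cball d), A f z = z.1 i • f z := by
  obtain ⟨M, hM, -⟩ := hk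
  exact UnitarilyInvariantKernel.exists_coordMul ⟨M i, hM i⟩

/-- The operator `M_{z_i} ⊗ I_E` of multiplication by `z_i` on `H_k(E)`. -/
def coordMul (hk : k.Admissible) (E : Type*) [NormedAddCommGroup E] [InnerProductSpace ℂ E]
    [CompleteSpace E] (i : Fin d) : HSpace k E →L[ℂ] HSpace k E :=
  (hk.exists_coordMul E i).choose

theorem coordMul_apply (hk : k.Admissible) (E : Type*) [NormedAddCommGroup E]
    [InnerProductSpace ℂ E] [CompleteSpace E] (i : Fin d) (f : HSpace k E) (z : cball d) :
    coordMul hk E i f z = z.1 i • f z :=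
  (hk.exists_coordMul E i).choose_spec f z

/-- The adjoint `V_T^*`. -/
def modelAdjoint (hT : k.IsPure T) : HSpace k (defectSpace hT.isContraction) →L[ℂ] H :=
  adjoint (modelIsometry hT).toContinuousLinearMap

theorem modelAdjoint_basisFun (hT : k.IsPure T) (α : Fin d → ℕ)
    (v : defectSpace hT.isContraction) :
    modelAdjoint hT (k.basisFun α v) =
      ((√(k.aM α) : ℝ) : ℂ) • tuplePow T α (defect hT.isContraction v) := by
  refine ext_inner_right ℂ fun h => ?_
  rw [modelAdjoint, adjoint_inner_left]
  have h1 := hasSum_inner_coord (k.basisFun α v) (modelIsometry hT h)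
  have h2 : inner ℂ (k.basisFun α v) (modelIsometry hT h) = inner ℂ v (modelCoord hT h α) := by
    refine h1.unique ?_
    convert! hasSum_ite_eq α (inner ℂ v (modelCoord hT h α)) using 2 with β
    rw [coord_basisFun]
    by_cases hβ : β = α
    · subst hβ; simp; rfl
    · simp [hβ]
  refine h2.trans ?_
  rw [modelCoord, inner_smul_right, inner_smul_left, Complex.conj_ofReal,
    ← adjoint_inner_right (tuplePow T α), ← adjoint_inner_right (defect hT.isContraction),
    adjoint_defect]
  rfl

/-- The intertwining relation `V_T^* (M_{z_i} ⊗ I) = T_i V_T^*`. -/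
theorem modelAdjoint_coordMul (hk : k.Admissible) (hT : k.IsPure T) (i : Fin d)
    (f : HSpace k (defectSpace hT.isContraction)) :
    modelAdjoint hT (coordMul hk _ i f) = T i (modelAdjoint hT f) := by
  have h1 := ((modelAdjoint hT).comp (coordMul hk _ i)).hasSum (k.hasSum_basisFun f)
  have h2 := ((T i).comp (modelAdjoint hT)).hasSum (k.hasSum_basisFun f)
  refine h1.unique ?_
  convert! h2 using 2 with α
  simp only [comp_apply]
  rw [k.coordMul_basisFun_of i _ (coordMul_apply hk _ i), map_smul, modelAdjoint_basisFun,
    modelAdjoint_basisFun, map_smul, smul_smul, tuplePow_add_single T hT.isContraction.commute,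
    ← Complex.ofReal_mul, shiftWeight_mul]
  rfl

/-- The closed subspace `Ker V_T^*` of `H_k ⊗ ran(Δ_T)^-`. -/
def modelKer (hT : k.IsPure T) : Submodule ℂ (HSpace k (defectSpace hT.isContraction)) :=
  LinearMap.ker (modelAdjoint hT).toLinearMap

instance (hT : k.IsPure T) : CompleteSpace (modelKer hT) :=
  (modelAdjoint hT).isClosed_ker.completeSpace_coe

/-- The associated tuple `B_T`: the restrictions of `M_{z_i} ⊗ I` to `Ker V_T^*`. -/
def assocTuple (hk : k.Admissible) (hT : k.IsPure T) (i : Fin d) :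
    modelKer hT →L[ℂ] modelKer hT :=
  ((coordMul hk _ i).comp (modelKer hT).subtypeL).codRestrict (modelKer hT) fun f => by
    have hf : modelAdjoint hT f = 0 := f.2
    change modelAdjoint hT (coordMul hk _ i f) = 0
    rw [modelAdjoint_coordMul, hf, map_zero]

/-- `θ` is a multiplier from `H_l(E)` to `H_k(F)` with multiplication operator `M`. -/
def IsMulOperator {l : UnitarilyInvariantKernel d} {E F : Type*} [NormedAddCommGroup E]
    [InnerProductSpace ℂ E] [CompleteSpace E] [NormedAddCommGroup F] [InnerProductSpace ℂ F]
    [CompleteSpace F] (θ : EuclideanSpace ℂ (Fin d) → E →L[ℂ] F)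
    (M : HSpace l E →L[ℂ] HSpace k F) : Prop :=
  ∀ (f : HSpace l E) (z : cball d), M f z = θ z (f z)

/-- The pure `1/k`-contraction `T` admits a characteristic function through the kernel `l`. -/
def AdmitsCharacteristicFunction (l : UnitarilyInvariantKernel d) (hT : k.IsPure T) : Prop :=
  ∃ (E : Type u) (_ : NormedAddCommGroup E) (_ : InnerProductSpace ℂ E) (_ : CompleteSpace E)
    (θ : EuclideanSpace ℂ (Fin d) → E →L[ℂ] defectSpace hT.isContraction)
    (M : HSpace l E →L[ℂ] HSpace k (defectSpace hT.isContraction)),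
    AnalyticOnNhd ℂ θ (cball d) ∧ IsMulOperator θ M ∧
      1 - (modelIsometry hT).toContinuousLinearMap ∘L modelAdjoint hT = M ∘L adjoint M

end operators

end UnitarilyInvariantKernel

end

noncomputable section

universe u

/-! Write `V` for the model isometry, so that `I - VV*` is the projection onto `Ker V*`. Let `J` be
the inclusion of that subspace. A characteristic function through `l` amounts to a coisometry `N :
H_l ⊗ E → Ker V*` intertwining the shifts with `B_T`: the two are related by `M_θ = J N`, and then
`M_θ M_θ* = J N N* J* = J J*`.

From a characteristic function to contractivity: `V* M_θ M_θ* = 0` forces the range of `M_θ` into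
`Ker V*`, so `N` exists and `N N* = I`. The shifts on `H_l ⊗ E` form a `1/l`-contraction, because
their defect series is diagonal with eigenvalues independent of `E` (`isContraction_coordMul`).
Compressing that series by `N` gives the one of `B_T` (`IsContraction.of_coisometry`).

From contractivity back: the first point is that `B_T` is automatically pure (`isPure_assocTuple`).
The projections to `Ker V*` of the kernel functions are total and are joint eigenvectors of the
adjoints `B_i*`. Between eigenvectors belonging to `z` and `w`, the squared defect acts as the
scalar `1 / l(z, w)`, and the purity series multiplies this by `l(z, w)`. Its partial sums are
positive and increasing, so weak convergence to `I` on a total set becomes strong convergence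
(`tendsto_of_monotone_of_dense`, `IsContraction.isPure`). The adjoint of the model isometry of
`B_T`, taken with respect to `l`, is then the required `N`.

It remains to see that an operator intertwining the shifts is multiplication by an analytic `θ`
(`exists_isMulOperator`). Here `θ(z) v` is the value at `z` of the image of the constant function
`v`, so analyticity reduces to that of point evaluation in operator norm (`analyticOnNhd_evalExt`).
For the Drury–Arveson space this is a resolvent formula in the backward shifts, and other kernels
follow by dilation. -/

theorem tuplePow_zero {R : Type*} [Monoid R] {d : ℕ} (T : Fin d → R) : tuplePow T 0 = 1 := by
  simp [tuplePow]

/-- Induction on multi-indices, one coordinate at a time. -/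
theorem multiIndex_induction {d : ℕ} {p : (Fin d → ℕ) → Prop} (zero : p 0)
    (add_single : ∀ α i, p α → p (α + Pi.single i 1)) (α : Fin d → ℕ) : p α := by
  induction h : ∑ i, α i generalizing α with
  | zero =>
    have : α = 0 := funext fun i => by simpa using Finset.sum_eq_zero_iff.1 h i
    exact this ▸ zero
  | succ n ih =>
    obtain ⟨i, hi⟩ : ∃ i, α i ≠ 0 := by
      by_contra! hc
      simp [hc] at h
    have hle : Pi.single i 1 ≤ α := by
      intro j
      by_cases hj : j = i
      · subst hj; simpa using Nat.one_le_iff_ne_zero.2 hi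
      · simp [hj]
    have hα : α - Pi.single i 1 + Pi.single i 1 = α := tsub_add_cancel_of_le hle
    rw [← hα]
    refine add_single _ i (ih _ ?_)
    rw [← hα] at h
    simpa [Finset.sum_add_distrib] using h

theorem monom_zero {d : ℕ} (z : EuclideanSpace ℂ (Fin d)) : monom 0 z = 1 := by
  simp [monom]

theorem norm_inner_lt_one {d : ℕ} {z w : EuclideanSpace ℂ (Fin d)} (hz : z ∈ cball d)
    (hw : w ∈ cball d) : ‖inner ℂ w z‖ < 1 := by
  rw [mem_ball_zero_iff] at hz hw
  refine (norm_inner_le_norm w z).trans_lt ?_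
  nlinarith [norm_nonneg w, norm_nonneg z]

namespace UnitarilyInvariantKernel

open ContinuousLinearMap

variable {d : ℕ}

theorem basisVal_zero (k : UnitarilyInvariantKernel d) (z : EuclideanSpace ℂ (Fin d)) :
    k.basisVal z 0 = 1 := by
  simp [basisVal, monom_zero, aM, k.a_zero, Nat.multinomial]

/-! ### Powers of commuting tuples and joint eigenvectors of their adjoints. -/

section tuples

variable {H K : Type*} [NormedAddCommGroup H] [InnerProductSpace ℂ H]
  [NormedAddCommGroup K] [InnerProductSpace ℂ K]
  {T : Fin d → H →L[ℂ] H} {B : Fin d → K →L[ℂ] K}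

theorem comp_tuplePow (hT : ∀ i j, Commute (T i) (T j)) (hB : ∀ i j, Commute (B i) (B j))
    {N : H →L[ℂ] K} (hN : ∀ i, N ∘L T i = B i ∘L N) (α : Fin d → ℕ) :
    N ∘L tuplePow T α = tuplePow B α ∘L N := by
  induction α using multiIndex_induction with
  | zero => simp [tuplePow_zero, one_def]
  | add_single α i ih =>
    rw [tuplePow_add_single T hT, tuplePow_add_single B hB, mul_def, mul_def, ← comp_assoc, hN,
      comp_assoc, ih, comp_assoc]

theorem adjoint_tuplePow_of_eigenvector [CompleteSpace H] (hT : ∀ i j, Commute (T i) (T j))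
    {x : H} {z : EuclideanSpace ℂ (Fin d)} (hx : ∀ i, adjoint (T i) x = star (z i) • x)
    (α : Fin d → ℕ) : adjoint (tuplePow T α) x = star (monom α z) • x := by
  induction α using multiIndex_induction with
  | zero => simp [tuplePow_zero, monom_zero, ← star_eq_adjoint]
  | add_single α i ih =>
    rw [tuplePow_add_single T hT, mul_def, adjoint_comp, comp_apply, hx, map_smul, ih,
      monom_add_single, smul_smul, star_mul']

end tuples

/-! ### Powers of the shifts on kernel functions and on the monomial basis. -/

section coordMul

variable {k : UnitarilyInvariantKernel d} (hk : k.Admissible)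
  (E : Type*) [NormedAddCommGroup E] [InnerProductSpace ℂ E] [CompleteSpace E]

theorem commute_coordMul (i j : Fin d) : Commute (coordMul hk E i) (coordMul hk E j) := by
  ext1 f
  refine RKHS.ext fun z => ?_
  simp only [mul_apply_eq_comp, coordMul_apply, smul_smul, mul_comm]

variable {E}

theorem tuplePow_coordMul_apply (α : Fin d → ℕ) (f : HSpace k E) (z : cball d) :
    tuplePow (coordMul hk E) α f z = monom α z.1 • f z := by
  induction α using multiIndex_induction generalizing f with
  | zero => simp [tuplePow_zero, monom_zero]
  | add_single α i ih =>
    rw [tuplePow_add_single _ (commute_coordMul hk E), mul_apply_eq_comp, coordMul_apply, ih,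
      monom_add_single, smul_smul]

theorem adjoint_coordMul_kerFun (i : Fin d) (z : cball d) (v : E) :
    adjoint (coordMul hk E i) (RKHS.kerFun (HSpace k E) z v) =
      star (z.1 i) • RKHS.kerFun (HSpace k E) z v := by
  refine ext_inner_right ℂ fun f => ?_
  rw [adjoint_inner_left, RKHS.kerFun_inner, coordMul_apply, inner_smul_right, inner_smul_left,
    RKHS.kerFun_inner]
  simp

theorem tuplePow_coordMul_basisFun (α β : Fin d → ℕ) (v : E) :
    tuplePow (coordMul hk E) α (k.basisFun β v) =
      ((√(k.aM β) / √(k.aM (β + α)) : ℝ) : ℂ) • k.basisFun (β + α) v := by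
  refine RKHS.ext fun z => ?_
  rw [tuplePow_coordMul_apply, RKHS.coe_smul, Pi.smul_apply, basisFun_apply, basisFun_apply,
    smul_smul, smul_smul]
  congr 1
  have h : monom (β + α) z.1 = monom β z.1 * monom α z.1 := by
    simp [monom, pow_add, Finset.prod_mul_distrib]
  have h0 : (√(k.aM (β + α)) : ℂ) ≠ 0 := by
    exact_mod_cast (Real.sqrt_pos.2 (k.aM_pos _)).ne'
  rw [basisVal, basisVal, h]
  push_cast
  field_simp

variable (k) in
theorem inner_basisFun (α : Fin d → ℕ) (v : E) (f : HSpace k E) :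
    inner ℂ (k.basisFun α v) f = inner ℂ v (coord f α) := by
  refine (hasSum_inner_coord (k.basisFun α v) f).unique ?_
  convert! hasSum_ite_eq α (inner ℂ v (coord f α)) using 2 with β
  rw [coord_basisFun]
  by_cases hβ : β = α
  · subst hβ; simp
  · simp [hβ]

theorem coord_adjoint_tuplePow_coordMul (α β : Fin d → ℕ) (f : HSpace k E) :
    coord (adjoint (tuplePow (coordMul hk E) α) f) β =
      ((√(k.aM β) / √(k.aM (β + α)) : ℝ) : ℂ) • coord f (β + α) := by
  refine ext_inner_left ℂ fun v => ?_
  rw [← inner_basisFun k, adjoint_inner_right, tuplePow_coordMul_basisFun, inner_smul_left,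
    inner_basisFun, inner_smul_right, Complex.conj_ofReal]

variable (k) in
open scoped Classical in
/-- The eigenvalue of `M^α (M^α)^*` on `√a_γ z^γ`. -/
def shiftEigenvalue (α γ : Fin d → ℕ) : ℝ :=
  if α ≤ γ then k.aM (γ - α) / k.aM γ else 0

/-- A direct computation on basis functions; moving the self-adjoint operator `M^α (M^α)*` across
the inner product carries it to arbitrary `f`. The eigenvalue does not depend on `E`, which is what
lets scalar admissibility pass to vector-valued spaces. -/
theorem coord_tuplePow_adjoint_tuplePow_coordMul (α γ : Fin d → ℕ) (f : HSpace k E) :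
    coord (tuplePow (coordMul hk E) α (adjoint (tuplePow (coordMul hk E) α) f)) γ =
      (k.shiftEigenvalue α γ : ℂ) • coord f γ := by
  have key : ∀ v : E, tuplePow (coordMul hk E) α (adjoint (tuplePow (coordMul hk E) α)
      (k.basisFun γ v)) = (k.shiftEigenvalue α γ : ℂ) • k.basisFun γ v := fun v => by
    by_cases h : α ≤ γ
    · have h1 : adjoint (tuplePow (coordMul hk E) α) (k.basisFun γ v) =
          ((√(k.aM (γ - α)) / √(k.aM γ) : ℝ) : ℂ) • k.basisFun (γ - α) v := by
        refine coord_ext fun β => ?_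
        rw [coord_adjoint_tuplePow_coordMul, coord_smul, coord_basisFun, coord_basisFun]
        by_cases hβ : β = γ - α
        · subst hβ
          simp [tsub_add_cancel_of_le h]
        · have : β + α ≠ γ := fun hh => hβ (by rw [← hh, add_tsub_cancel_right])
          simp [hβ, this]
      rw [h1, map_smul, tuplePow_coordMul_basisFun, tsub_add_cancel_of_le h, smul_smul,
        ← Complex.ofReal_mul, shiftEigenvalue, if_pos h, div_mul_div_comm,
        Real.mul_self_sqrt (k.aM_pos _).le, Real.mul_self_sqrt (k.aM_pos _).le]
    · have h1 : adjoint (tuplePow (coordMul hk E) α) (k.basisFun γ v) = 0 := by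
        refine coord_ext fun β => ?_
        have : β + α ≠ γ := fun hh => h (hh ▸ le_add_self)
        rw [coord_adjoint_tuplePow_coordMul, coord_basisFun, Pi.single_eq_of_ne this, smul_zero]
        rfl
      rw [h1, map_zero, shiftEigenvalue, if_neg h, Complex.ofReal_zero, zero_smul]
  refine ext_inner_left ℂ fun v => ?_
  rw [← inner_basisFun k, ← adjoint_inner_left, adjoint_inner_right, key, inner_smul_left,
    inner_basisFun, inner_smul_right, Complex.conj_ofReal]

end coordMul

end UnitarilyInvariantKernel

namespace UnitarilyInvariantKernel

open ContinuousLinearMap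

variable {d : ℕ}

/-! ### Diagonal operators and their strong convergence. -/

section diagonal

variable (k k' : UnitarilyInvariantKernel d)
  {E : Type*} [NormedAddCommGroup E] [InnerProductSpace ℂ E]

/-- The coordinate functional `f ↦ f_α`. -/
def coordCLM (α : Fin d → ℕ) : HSpace k E →L[ℂ] E :=
  LinearMap.mkContinuous
    { toFun := fun f => coord f α
      map_add' := fun f g => coord_add f g α
      map_smul' := fun c f => coord_smul c f α }
    1 fun f => by
      rw [one_mul]
      exact lp.norm_apply_le_norm (by norm_num) (toL2 f) α

theorem coordCLM_apply (α : Fin d → ℕ) (f : HSpace k E) : k.coordCLM α f = coord f α := rfl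

theorem norm_coord_le (f : HSpace k E) (α : Fin d → ℕ) : ‖coord f α‖ ≤ ‖f‖ :=
  lp.norm_apply_le_norm (by norm_num) (toL2 f) α

variable {k} in
theorem norm_le_of_coord {f : HSpace k E} {g : HSpace k' E} {C : ℝ} (hC : 0 ≤ C)
    (h : ∀ α, ‖coord g α‖ ≤ C * ‖coord f α‖) : ‖g‖ ≤ C * ‖f‖ := by
  refine le_of_sq_le_sq ?_ (by positivity)
  rw [mul_pow]
  refine hasSum_le (fun α => ?_) (hasSum_norm_coord g) ((hasSum_norm_coord f).mul_left (C ^ 2))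
  rw [← mul_pow]
  exact pow_le_pow_left₀ (norm_nonneg _) (h α) 2

variable {k} in
theorem memℓp_smul_coord {σ : (Fin d → ℕ) → ℂ} {C : ℝ} (hσ : ∀ α, ‖σ α‖ ≤ C) (f : HSpace k E) :
    Memℓp (fun α => σ α • coord f α) 2 := by
  refine memℓp_gen ?_
  have h : ∀ α, ‖σ α • coord f α‖ ^ 2 ≤ C ^ 2 * ‖coord f α‖ ^ 2 := fun α => by
    rw [norm_smul, mul_pow]
    gcongr
    exact hσ α
  simpa using Summable.of_nonneg_of_le (fun α => by positivity) h
    ((hasSum_norm_coord f).summable.mul_left _)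

/-- The operator multiplying the coordinates by a bounded family of scalars. -/
def diagonal (σ : (Fin d → ℕ) → ℂ) {C : ℝ} (hC : 0 ≤ C) (hσ : ∀ α, ‖σ α‖ ≤ C) :
    HSpace k E →L[ℂ] HSpace k' E :=
  LinearMap.mkContinuous
    { toFun := fun f => ofCoord k' (fun α => σ α • coord f α) (memℓp_smul_coord hσ f)
      map_add' := fun f g => coord_ext fun α => by
        simp only [coord_add, coord_ofCoord, smul_add]
      map_smul' := fun c f => coord_ext fun α => by
        simp only [coord_smul, coord_ofCoord, smul_comm c, RingHom.id_apply] }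
    C fun f => norm_le_of_coord k' hC fun α => by
      change ‖σ α • coord f α‖ ≤ _
      rw [norm_smul]
      gcongr
      exact hσ α

theorem coord_diagonal (σ : (Fin d → ℕ) → ℂ) {C : ℝ} (hC : 0 ≤ C) (hσ : ∀ α, ‖σ α‖ ≤ C)
    (f : HSpace k E) (α) : coord (diagonal k k' σ hC hσ f) α = σ α • coord f α := rfl

theorem norm_diagonal_le (σ : (Fin d → ℕ) → ℂ) {C : ℝ} (hC : 0 ≤ C) (hσ : ∀ α, ‖σ α‖ ≤ C) :
    ‖(diagonal k k' σ hC hσ : HSpace k E →L[ℂ] HSpace k' E)‖ ≤ C :=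
  LinearMap.mkContinuous_norm_le _ hC _

/-- Uniformly bounded diagonal operators converge strongly if their entries converge. -/
theorem tendsto_of_coord_eq_smul {g : ℕ → HSpace k E} {f g' : HSpace k E}
    {s : ℕ → (Fin d → ℕ) → ℂ} {σ : (Fin d → ℕ) → ℂ} {C : ℝ} (hsC : ∀ n α, ‖s n α‖ ≤ C)
    (hs : ∀ α, Tendsto (fun n => s n α) atTop (𝓝 (σ α)))
    (hg : ∀ n α, coord (g n) α = s n α • coord f α) (hg' : ∀ α, coord g' α = σ α • coord f α) :
    Tendsto g atTop (𝓝 g') := by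
  have hC : 0 ≤ C := (norm_nonneg _).trans (hsC 0 0)
  have hσC : ∀ α, ‖σ α‖ ≤ C := fun α => le_of_tendsto (hs α).norm (.of_forall fun n => hsC n α)
  have hcoord : ∀ n α, coord (g n - g') α = (s n α - σ α) • coord f α := fun n α => by
    rw [← coordCLM_apply, map_sub, coordCLM_apply, coordCLM_apply, hg, hg', sub_smul]
  -- Dominated convergence for the sum of squared coordinate norms; both the entries and their
  -- limits are bounded by `C`, so the differences are bounded by `2 * C`.
  have h1 : Tendsto (fun n => ∑' α, ‖coord (g n - g') α‖ ^ 2) atTop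
      (𝓝 (∑' _ : Fin d → ℕ, (0 : ℝ))) := by
    refine tendsto_tsum_of_dominated_convergence (bound := fun α => (2 * C) ^ 2 * ‖coord f α‖ ^ 2)
      ((hasSum_norm_coord f).summable.mul_left _) (fun α => ?_) (.of_forall fun n α => ?_)
    · have := (((hs α).sub_const (σ α)).smul_const (coord f α)).norm.pow 2
      simpa [hcoord] using this
    · rw [hcoord, norm_smul, mul_pow, Real.norm_of_nonneg (by positivity)]
      gcongr
      refine (norm_sub_le _ _).trans ?_
      linarith [hsC n α, hσC α]
  simp only [(hasSum_norm_coord _).tsum_eq, tsum_zero] at h1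
  have h2 := (Real.continuous_sqrt.tendsto 0).comp h1
  rw [tendsto_iff_norm_sub_tendsto_zero]
  simpa [Function.comp_def, Real.sqrt_sq] using h2

end diagonal

/-! ### Passing admissibility from `H_k` to `H_k ⊗ E`. -/

section amplification

variable {k : UnitarilyInvariantKernel d} (hk : k.Admissible)

variable (k) in
/-- The eigenvalue on `√a_γ z^γ` of the partial sums of `∑_{α ≠ 0} b_α M^α (M^α)^*`. -/
def defectEigenvalue (N : ℕ) (γ : Fin d → ℕ) : ℂ :=
  ∑ α ∈ (degLE d N).erase 0, (k.bM α : ℂ) * k.shiftEigenvalue α γ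

theorem coord_defectSum_coordMul {E : Type*} [NormedAddCommGroup E] [InnerProductSpace ℂ E]
    [CompleteSpace E] (N : ℕ) (f : HSpace k E) (γ : Fin d → ℕ) :
    coord (∑ α ∈ (degLE d N).erase 0, (k.bM α : ℂ) • tuplePow (coordMul hk E) α
      (adjoint (tuplePow (coordMul hk E) α) f)) γ = k.defectEigenvalue N γ • coord f γ := by
  rw [← coordCLM_apply, map_sum, defectEigenvalue, Finset.sum_smul]
  refine Finset.sum_congr rfl fun α _ => ?_
  rw [map_smul, coordCLM_apply, coord_tuplePow_adjoint_tuplePow_coordMul, smul_smul]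

theorem isContraction_coordMul_scalar : k.IsContraction (coordMul hk ℂ) := by
  obtain ⟨M, hM, h⟩ := id hk
  have : coordMul hk ℂ = M := by
    funext i
    ext1 f
    refine RKHS.ext fun z => ?_
    rw [coordMul_apply, hM]
  rwa [this]

/-- For an admissible kernel, the tuple `M_z ⊗ I_E` is a `1/k`-contraction. -/
theorem isContraction_coordMul (E : Type*) [NormedAddCommGroup E] [InnerProductSpace ℂ E]
    [CompleteSpace E] : k.IsContraction (coordMul hk E) := by
  obtain ⟨S, hS1, hS⟩ := (isContraction_coordMul_scalar hk).exists_sum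
  let A : ℕ → HSpace k ℂ →L[ℂ] HSpace k ℂ := fun N => ∑ α ∈ (degLE d N).erase 0,
    (k.bM α : ℂ) • tuplePow (coordMul hk ℂ) α ∘L adjoint (tuplePow (coordMul hk ℂ) α)
  have hA : ∀ N f, A N f = ∑ α ∈ (degLE d N).erase 0, (k.bM α : ℂ) •
      tuplePow (coordMul hk ℂ) α (adjoint (tuplePow (coordMul hk ℂ) α) f) := fun N f => by
    simp [A, sum_apply]
  -- Strong convergence alone gives, by uniform boundedness, a bound on the partial sums and hence
  -- on all their eigenvalues at once.
  obtain ⟨C, hC⟩ := banach_steinhaus (g := A) fun f => by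
    have h := (hS f).norm.bddAbove_range
    obtain ⟨C, hC⟩ := h
    exact ⟨C, fun N => by rw [hA]; exact hC ⟨N, rfl⟩⟩
  have he : ∀ N γ, coord (A N (k.basisFun γ 1)) γ = k.defectEigenvalue N γ := fun N γ => by
    rw [hA, coord_defectSum_coordMul, coord_basisFun, Pi.single_eq_same, smul_eq_mul, mul_one]
  have hbound : ∀ N γ, ‖k.defectEigenvalue N γ‖ ≤ C := fun N γ => by
    rw [← he]
    refine (norm_coord_le k _ _).trans (((A N).le_of_opNorm_le (hC N) _).trans ?_)
    rw [norm_basisFun, norm_one, mul_one]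
  -- The limiting eigenvalues are read off from the scalar sum `S`; they inherit the bound `1` from
  -- `‖S‖ ≤ 1`.
  let σ : (Fin d → ℕ) → ℂ := fun γ => coord (S (k.basisFun γ 1)) γ
  have hlim : ∀ γ, Tendsto (fun N => k.defectEigenvalue N γ) atTop (𝓝 (σ γ)) := fun γ => by
    refine (((k.coordCLM γ).continuous.tendsto _).comp (hS (k.basisFun γ 1))).congr fun N => ?_
    rw [← he, hA]
    rfl
  have hσ : ∀ γ, ‖σ γ‖ ≤ 1 := fun γ => by
    refine (norm_coord_le k _ _).trans ((S.le_of_opNorm_le hS1 _).trans ?_)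
    rw [norm_basisFun, norm_one, mul_one]
  exact ⟨commute_coordMul hk E, diagonal k k σ zero_le_one hσ, norm_diagonal_le _ _ _ _ _,
    fun f => tendsto_of_coord_eq_smul k hbound hlim (coord_defectSum_coordMul hk · f)
      fun α => coord_diagonal _ _ _ _ _ _ _⟩

end amplification

end UnitarilyInvariantKernel

/-! ### Convergence of the series of the `bₙ` and its relation to the kernel. -/

namespace UnitarilyInvariantKernel

open ContinuousLinearMap

variable {d : ℕ}

/-- Each `B^α` acts on the eigenvectors through a scalar monomial, so an operator series collapses
to a power series. It is used with `D = 1` for the defect series and with `D` the squared defect for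
the purity series. -/
theorem inner_sum_tuplePow_adjoint {K : Type*} [NormedAddCommGroup K] [InnerProductSpace ℂ K]
    [CompleteSpace K] {B : Fin d → K →L[ℂ] K} (hB : ∀ i j, Commute (B i) (B j)) {x y : K}
    {z w : EuclideanSpace ℂ (Fin d)} (hy : ∀ i, adjoint (B i) y = star (z i) • y)
    (hx : ∀ i, adjoint (B i) x = star (w i) • x) (D : K →L[ℂ] K)
    (s : Finset (Fin d → ℕ)) (c : (Fin d → ℕ) → ℂ) :
    inner ℂ y (∑ α ∈ s, c α • tuplePow B α (D (adjoint (tuplePow B α) x))) =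
      (∑ α ∈ s, c α * monom α z * star (monom α w)) * inner ℂ y (D x) := by
  rw [inner_sum, Finset.sum_mul]
  refine Finset.sum_congr rfl fun α _ => ?_
  rw [inner_smul_right, ← adjoint_inner_left, adjoint_tuplePow_of_eigenvector hB hy,
    adjoint_tuplePow_of_eigenvector hB hx, map_smul, inner_smul_left, inner_smul_right]
  simp
  ring

variable (k : UnitarilyInvariantKernel d)

theorem constantCoeff_mk_ne_zero : PowerSeries.constantCoeff (PowerSeries.mk k.a) ≠ 0 := by
  simp [k.a_zero]

theorem b_zero : k.b 0 = 0 := by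
  simp [b, k.a_zero]

theorem sum_degLE_bM (z w : EuclideanSpace ℂ (Fin d)) (N : ℕ) :
    ∑ α ∈ (degLE d N).erase 0, (k.bM α : ℂ) * monom α z * star (monom α w) =
      ∑ n ∈ Finset.range (N + 1), (k.b n : ℂ) * inner ℂ w z ^ n := by
  -- Omitting the index `0` changes nothing, since `b₀ = 0`.
  rw [Finset.sum_erase _ (by simp [bM, b_zero])]
  have := sum_degLE (fun n => (k.b n : ℂ)) (fun i => z i * star (w i)) N
  rw [PiLp.inner_apply]
  simp only [RCLike.inner_apply]
  refine Eq.trans (Finset.sum_congr rfl fun α _ => ?_) this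
  simp only [monom, mul_pow, Finset.prod_mul_distrib, bM, star_prod, star_pow]
  push_cast
  ring

variable {k}

/-- Kernel functions are eigenvectors of the adjoint shifts. Pairing the defect series with two of
them gives the scalar partial sums times `k(z, w)`, and this factor can be divided out because the
kernel has no zeros. -/
theorem tendsto_sum_b_of_admissible (hk : k.Admissible) {z w : EuclideanSpace ℂ (Fin d)}
    (hz : z ∈ cball d) (hw : w ∈ cball d) : ∃ s, Tendsto
      (fun N => ∑ n ∈ Finset.range (N + 1), (k.b n : ℂ) * inner ℂ w z ^ n) atTop (𝓝 s) := by
  obtain ⟨S, -, hS⟩ := (isContraction_coordMul_scalar hk).exists_sum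
  let y := RKHS.kerFun (HSpace k ℂ) ⟨z, hz⟩ 1
  let x := RKHS.kerFun (HSpace k ℂ) ⟨w, hw⟩ 1
  have hyx : inner ℂ y x = k.toFun z w := by
    rw [RKHS.kerFun_inner, RKHS.kerFun_apply, kernel_HSpace]
    simp
  have h := ((innerSL ℂ y).continuous.tendsto _).comp (hS x)
  have h2 : ∀ N, (innerSL ℂ y) (∑ α ∈ (degLE d N).erase 0, (k.bM α : ℂ) •
      tuplePow (coordMul hk ℂ) α (adjoint (tuplePow (coordMul hk ℂ) α) x)) =
        (∑ n ∈ Finset.range (N + 1), (k.b n : ℂ) * inner ℂ w z ^ n) * k.toFun z w := fun N => by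
    have h3 := inner_sum_tuplePow_adjoint (commute_coordMul hk ℂ)
      (fun i => adjoint_coordMul_kerFun hk i ⟨z, hz⟩ 1)
      (fun i => adjoint_coordMul_kerFun hk i ⟨w, hw⟩ 1) 1 ((degLE d N).erase 0)
      fun α => (k.bM α : ℂ)
    simp only [one_apply_eq_self] at h3
    rw [innerSL_apply_apply, h3, hyx, sum_degLE_bM]
  have h0 : k.toFun z w ≠ 0 := k.ne_zero z hz w hw
  refine ⟨_, (h.mul_const (k.toFun z w)⁻¹).congr fun N => ?_⟩
  rw [Function.comp_apply, h2, mul_assoc, mul_inv_cancel₀ h0, mul_one]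

/-- The point `z = √‖t‖ e₁` lies in the ball and has `⟨z, z⟩ = ‖t‖`; a coordinate direction exists
because `d ≥ 1`. -/
theorem summable_norm_a (hd : 1 ≤ d) {t : ℂ} (ht : ‖t‖ < 1) :
    Summable fun n => ‖(k.a n : ℂ) * t ^ n‖ := by
  let z : EuclideanSpace ℂ (Fin d) := EuclideanSpace.single ⟨0, hd⟩ (√‖t‖ : ℂ)
  have hz : inner ℂ z z = (‖t‖ : ℂ) := by
    simp [z, inner_self_eq_norm_sq_to_K, ← Complex.ofReal_pow]
  have hzb : z ∈ cball d := by
    simpa [z, abs_of_nonneg, Real.sqrt_lt' one_pos] using ht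
  refine (k.summable z hzb z hzb).norm.congr fun n => ?_
  rw [hz]
  simp

/-- Abel's argument: convergence at some `r` with `‖t‖ < r < 1` bounds the terms there, and the
terms at `t` are then dominated by a geometric series of ratio `‖t‖ / r`. -/
theorem summable_norm_b (hd : 1 ≤ d) (hk : k.Admissible) {t : ℂ} (ht : ‖t‖ < 1) :
    Summable fun n => ‖(k.b n : ℂ) * t ^ n‖ := by
  obtain ⟨r, hr, hr1⟩ := exists_between ht
  have hr0 : 0 < r := (norm_nonneg t).trans_lt hr
  let z : EuclideanSpace ℂ (Fin d) := EuclideanSpace.single ⟨0, hd⟩ (√r : ℂ)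
  have hz : inner ℂ z z = (r : ℂ) := by
    simp [z, inner_self_eq_norm_sq_to_K, ← Complex.ofReal_pow, hr0.le]
  have hzb : z ∈ cball d := by
    simpa [z, abs_of_nonneg, Real.sqrt_lt' one_pos] using hr1
  obtain ⟨s, hs⟩ := tendsto_sum_b_of_admissible hk hzb hzb
  rw [hz] at hs
  -- The terms tend to zero as differences of consecutive partial sums, which run up to and
  -- including the index `N`.
  have hb : Tendsto (fun n => (k.b (n + 1) : ℂ) * (r : ℂ) ^ (n + 1)) atTop (𝓝 0) := by
    have := (hs.comp (tendsto_add_atTop_nat 1)).sub hs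
    rw [sub_self] at this
    refine this.congr fun n => ?_
    rw [Function.comp_apply, Finset.sum_range_succ _ (n + 1), add_sub_cancel_left]
  obtain ⟨C, hC⟩ :=
    ((tendsto_add_atTop_iff_nat (f := fun n => (k.b n : ℂ) * (r : ℂ) ^ n) 1).1 hb).norm.bddAbove_range
  refine Summable.of_nonneg_of_le (fun _ => norm_nonneg _) (fun n => ?_)
    ((summable_geometric_of_lt_one (div_nonneg (norm_nonneg t) hr0.le)
      ((div_lt_one hr0).2 hr)).mul_left C)
  have h1 : ‖(k.b n : ℂ) * t ^ n‖ = ‖(k.b n : ℂ) * (r : ℂ) ^ n‖ * (‖t‖ / r) ^ n := by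
    rw [norm_mul, norm_mul, norm_pow, norm_pow, Complex.norm_of_nonneg hr0.le, mul_assoc,
      ← mul_pow, mul_div_cancel₀ _ hr0.ne']
  rw [h1]
  gcongr
  exact hC ⟨n, rfl⟩

/-- For an admissible kernel, `∑ bₙ tⁿ` converges for `|t| < 1`, to `1 - 1 / ∑ aₙ tⁿ`. -/
theorem exists_tendsto_sum_b (hd : 1 ≤ d) (hk : k.Admissible) {z w : EuclideanSpace ℂ (Fin d)}
    (hz : z ∈ cball d) (hw : w ∈ cball d) : ∃ s, Tendsto
      (fun N => ∑ n ∈ Finset.range (N + 1), (k.b n : ℂ) * inner ℂ w z ^ n) atTop (𝓝 s) ∧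
        k.toFun z w * (1 - s) = 1 := by
  set t : ℂ := inner ℂ w z
  have ht : ‖t‖ < 1 := norm_inner_lt_one hz hw
  have hb := summable_norm_b hd hk ht
  have ha := summable_norm_a (k := k) hd ht
  refine ⟨_, hb.of_norm.hasSum.tendsto_sum_nat.comp (tendsto_add_atTop_nat 1), ?_⟩
  -- The coefficients of the reciprocal power series, so that `c₀ = 1` and `cₙ = -bₙ` for `n ≥ 1`.
  -- Absolute convergence turns the formal identity into one of values via the Cauchy product.
  let c : ℕ → ℝ := fun n => PowerSeries.coeff n (PowerSeries.mk k.a)⁻¹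
  have hc : ∀ n, (c n : ℂ) * t ^ n = (if n = 0 then 1 else 0) - (k.b n : ℂ) * t ^ n := fun n => by
    have : k.b n = (if n = 0 then 1 else 0) - c n := by
      rw [b, map_sub, PowerSeries.coeff_one]
    rw [this]
    by_cases h : n = 0
    · simp [h]
    · simp [h]
  have h1 : Summable fun n : ℕ => ‖(if n = 0 then 1 else 0 : ℂ)‖ :=
    (hasSum_ite_eq 0 (1 : ℂ)).summable.norm
  have hcs : Summable fun n => ‖(c n : ℂ) * t ^ n‖ := by
    refine Summable.of_nonneg_of_le (fun _ => norm_nonneg _) (fun n => ?_) (h1.add hb)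
    rw [hc]
    exact norm_sub_le _ _
  have hct : ∑' n, (c n : ℂ) * t ^ n = 1 - ∑' n, (k.b n : ℂ) * t ^ n := by
    rw [tsum_congr hc, h1.of_norm.tsum_sub hb.of_norm, tsum_ite_eq]
  rw [← hct]
  change (∑' n, (k.a n : ℂ) * t ^ n) * _ = 1
  rw [tsum_mul_tsum_eq_tsum_sum_antidiagonal_of_summable_norm ha hcs]
  have hprod : ∀ n, ∑ p ∈ Finset.HasAntidiagonal.antidiagonal n, (k.a p.1 : ℂ) * t ^ p.1 * ((c p.2 : ℂ) * t ^ p.2)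
      = if n = 0 then 1 else 0 := fun n => by
    have h2 : ∑ p ∈ Finset.HasAntidiagonal.antidiagonal n, k.a p.1 * c p.2 = if n = 0 then 1 else 0 := by
      rw [← PowerSeries.coeff_one (R := ℝ) n,
        ← PowerSeries.mul_inv_cancel _ k.constantCoeff_mk_ne_zero, PowerSeries.coeff_mul]
      simp [c]
    have h3 : ∀ p ∈ Finset.HasAntidiagonal.antidiagonal n, (k.a p.1 : ℂ) * t ^ p.1 * ((c p.2 : ℂ) * t ^ p.2) =
        ((k.a p.1 * c p.2 : ℝ) : ℂ) * t ^ n := fun p hp => by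
      rw [← Finset.HasAntidiagonal.mem_antidiagonal.1 hp, pow_add]
      push_cast
      ring
    rw [Finset.sum_congr rfl h3, ← Finset.sum_mul, ← Complex.ofReal_sum, h2]
    by_cases h : n = 0
    · simp [h]
    · simp [h]
  rw [tsum_congr hprod, tsum_ite_eq]

end UnitarilyInvariantKernel

/-! ### Strong limits of monotone sequences and a criterion for purity. -/

namespace UnitarilyInvariantKernel

open ContinuousLinearMap

section strongLimit

variable {K : Type*} [NormedAddCommGroup K] [InnerProductSpace ℂ K] [CompleteSpace K]

theorem tendsto_inner_span {P : ℕ → K →L[ℂ] K} {D : Set K}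
    (hD : ∀ y ∈ D, ∀ x ∈ D, Tendsto (fun N => inner ℂ y (P N x)) atTop (𝓝 (inner ℂ y x)))
    {x y : K} (hy : y ∈ Submodule.span ℂ D) (hx : x ∈ Submodule.span ℂ D) :
    Tendsto (fun N => inner ℂ y (P N x)) atTop (𝓝 (inner ℂ y x)) := by
  have h1 : ∀ y ∈ D, Tendsto (fun N => inner ℂ y (P N x)) atTop (𝓝 (inner ℂ y x)) := by
    intro y hy
    induction hx using Submodule.span_induction with
    | mem x hx => exact hD y hy x hx
    | zero => simp
    | add u v _ _ hu hv => simpa [inner_add_right] using hu.add hv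
    | smul c u _ hu => simpa [inner_smul_right] using hu.const_mul c
  induction hy using Submodule.span_induction with
  | mem y hy => exact h1 y hy
  | zero => simp
  | add u v _ _ hu hv => simpa [inner_add_left] using hu.add hv
  | smul c u _ hu => simpa [inner_smul_left] using hu.mul_const (starRingEnd ℂ c)

/-- An increasing sequence of positive operators that converges weakly to the identity on a total
set converges strongly to the identity. -/
theorem tendsto_of_monotone_of_dense {P : ℕ → K →L[ℂ] K} (hP0 : ∀ N, 0 ≤ P N) (hP : Monotone P)
    {D : Set K} (hdense : (Submodule.span ℂ D).topologicalClosure = ⊤)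
    (hD : ∀ y ∈ D, ∀ x ∈ D, Tendsto (fun N => inner ℂ y (P N x)) atTop (𝓝 (inner ℂ y x)))
    (x : K) : Tendsto (fun N => P N x) atTop (𝓝 x) := by
  have hd : Dense (Submodule.span ℂ D : Set K) :=
    Submodule.dense_iff_topologicalClosure_eq_top.2 hdense
  have hre : ∀ x ∈ Submodule.span ℂ D,
      Tendsto (fun N => (inner ℂ x (P N x)).re) atTop (𝓝 (‖x‖ ^ 2)) := fun x hx => by
    have := (Complex.continuous_re.tendsto _).comp (tendsto_inner_span hD hx hx)
    convert! this using 2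
    exact (inner_self_eq_norm_sq (𝕜 := ℂ) x).symm
  -- On the span, monotonicity keeps the quadratic form below its limit; the inequality is a closed
  -- condition and so extends to all of `K`. Positivity then gives `‖P N‖ ≤ 1`.
  have hle : ∀ N x, (inner ℂ x (P N x)).re ≤ ‖x‖ ^ 2 := fun N x => by
    have hclosed : IsClosed {x : K | (inner ℂ x (P N x)).re ≤ ‖x‖ ^ 2} :=
      isClosed_le (by fun_prop) (by fun_prop)
    refine hclosed.closure_subset_iff.2 (fun x (hx : x ∈ Submodule.span ℂ D) => ?_) (hd x)
    refine Monotone.ge_of_tendsto (fun M N hMN => ?_) (hre x hx) N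
    have := ((ContinuousLinearMap.le_def _ _).1 (hP hMN)).re_inner_nonneg_right x
    simpa [inner_sub_right] using this
  have hnorm : ∀ N, ‖P N‖ ≤ 1 := fun N => by
    rw [CStarAlgebra.norm_le_one_iff_of_nonneg _ (hP0 N), ContinuousLinearMap.le_def, isPositive_def']
    refine ⟨(IsSelfAdjoint.one _).sub (IsSelfAdjoint.of_nonneg (hP0 N)), fun x => ?_⟩
    rw [reApplyInnerSelf, ← inner_re_symm]
    have := hle N x
    simpa [inner_sub_right, ← Complex.ofReal_pow] using this
  have hspan : ∀ x ∈ Submodule.span ℂ D, Tendsto (fun N => P N x) atTop (𝓝 x) := fun x hx => by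
    -- Expand the square and use `‖P N x‖ ≤ ‖x‖`; this is how weak convergence becomes norm
    -- convergence.
    have h1 : ∀ N, ‖P N x - x‖ ^ 2 ≤ 2 * (‖x‖ ^ 2 - (inner ℂ x (P N x)).re) := fun N => by
      have h2 := norm_sub_sq (𝕜 := ℂ) (P N x) x
      rw [inner_re_symm] at h2
      have h3 : ‖P N x‖ ≤ ‖x‖ := by simpa using (P N).le_of_opNorm_le (hnorm N) x
      have h4 : ‖P N x‖ ^ 2 ≤ ‖x‖ ^ 2 := by gcongr
      have h5 : RCLike.re (inner ℂ x (P N x)) = (inner ℂ x (P N x)).re := rfl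
      linarith
    have h2 : Tendsto (fun N => ‖P N x - x‖ ^ 2) atTop (𝓝 0) := by
      refine squeeze_zero (fun N => by positivity) h1 ?_
      have h := ((hre x hx).const_sub (‖x‖ ^ 2)).const_mul 2
      rwa [sub_self, mul_zero] at h
    have h3 := (Real.continuous_sqrt.tendsto 0).comp h2
    rw [tendsto_iff_norm_sub_tendsto_zero]
    simpa [Function.comp_def, Real.sqrt_sq] using h3
  rw [Metric.tendsto_atTop]
  intro ε hε
  obtain ⟨y, hy, hxy⟩ := hd.exists_dist_lt x (ε := ε / 3) (by positivity)
  obtain ⟨N₀, hN₀⟩ := Metric.tendsto_atTop.1 (hspan y hy) (ε / 3) (by positivity)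
  refine ⟨N₀, fun N hN => ?_⟩
  have h1 : dist (P N x) (P N y) ≤ dist x y := by
    rw [dist_eq_norm, dist_eq_norm, ← map_sub]
    simpa using (P N).le_of_opNorm_le (hnorm N) (x - y)
  have h2 := dist_triangle4 (P N x) (P N y) y x
  have h3 := hN₀ N hN
  rw [dist_comm y x] at h2
  linarith

end strongLimit

variable {d : ℕ} {k : UnitarilyInvariantKernel d} {K : Type*} [NormedAddCommGroup K]
  [InnerProductSpace ℂ K] [CompleteSpace K] {B : Fin d → K →L[ℂ] K}

theorem HasDefectSum.isSelfAdjoint {S : K →L[ℂ] K} (hS : k.HasDefectSum B S) :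
    IsSelfAdjoint S := by
  rw [isSelfAdjoint_iff_isSymmetric]
  intro x y
  have h1 := (hS x).inner (tendsto_const_nhds (x := y)) (𝕜 := ℂ)
  have h2 := (tendsto_const_nhds (x := x)).inner (hS y) (𝕜 := ℂ)
  refine tendsto_nhds_unique (h1.congr fun N => ?_) h2
  rw [sum_inner, inner_sum]
  refine Finset.sum_congr rfl fun α _ => ?_
  rw [inner_smul_left, inner_smul_right, Complex.conj_ofReal, ← adjoint_inner_right,
    adjoint_inner_left]

/-- The square root returns its argument when squared only if that argument is positive. Here it is
`I - S` with `S` a self-adjoint contraction. -/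
theorem defect_sq (hB : k.IsContraction B) : defect hB ^ 2 = 1 - hB.exists_sum.choose := by
  refine CFC.sq_sqrt _ ?_
  obtain ⟨h1, h2⟩ := hB.exists_sum.choose_spec
  rw [nonneg_iff_isPositive, isPositive_def']
  refine ⟨(IsSelfAdjoint.one _).sub h2.isSelfAdjoint, fun x => ?_⟩
  have h3 : ‖inner ℂ (hB.exists_sum.choose x) x‖ ≤ ‖x‖ ^ 2 := by
    refine (norm_inner_le_norm _ _).trans ?_
    have := hB.exists_sum.choose.le_of_opNorm_le h1 x
    rw [one_mul] at this
    nlinarith [norm_nonneg x]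
  have h4 := (Complex.re_le_norm _).trans h3
  simpa [reApplyInnerSelf, inner_sub_left, ← Complex.ofReal_pow] using h4

/-- A `1/k`-contraction whose adjoints have a total set of joint eigenvectors with eigenvalues in
the ball is pure. -/
theorem IsContraction.isPure (hd : 1 ≤ d) (hk : k.Admissible) (hB : k.IsContraction B)
    {D : Set K} (hdense : (Submodule.span ℂ D).topologicalClosure = ⊤)
    (hD : ∀ x ∈ D, ∃ z ∈ cball d, ∀ i, adjoint (B i) x = star (z i) • x) : k.IsPure B := by
  refine ⟨hB, ?_⟩
  let P : ℕ → K →L[ℂ] K := fun N => ∑ α ∈ degLE d N, (k.aM α : ℂ) •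
    tuplePow B α ∘L (defect hB ^ 2) ∘L adjoint (tuplePow B α)
  have hpos : ∀ α, 0 ≤ (k.aM α : ℂ) •
      tuplePow B α ∘L (defect hB ^ 2) ∘L adjoint (tuplePow B α) := fun α => by
    have h1 : 0 ≤ defect hB := CFC.sqrt_nonneg _
    have h2 : 0 ≤ defect hB ^ 2 := (IsSelfAdjoint.of_nonneg h1).sq_nonneg
    rw [nonneg_iff_isPositive] at h2 ⊢
    exact (h2.conj_adjoint _).smul_of_nonneg (by exact_mod_cast (k.aM_pos α).le)
  have hP : ∀ N x, P N x = ∑ α ∈ degLE d N, (k.aM α : ℂ) •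
      tuplePow B α ((defect hB ^ 2) (adjoint (tuplePow B α) x)) := fun N x => by
    simp [P, sum_apply]
  have hmono : Monotone (degLE d) := fun M N hMN α hα =>
    mem_degLE.2 ((mem_degLE.1 hα).trans hMN)
  intro x
  refine (tendsto_of_monotone_of_dense (P := P) (fun N => Finset.sum_nonneg fun α _ => hpos α)
    (fun M N hMN => Finset.sum_le_sum_of_subset_of_nonneg (hmono hMN) fun α _ _ => hpos α)
    hdense ?_ x).congr fun N => hP N x
  intro y hy x hx
  obtain ⟨z, hz, hyz⟩ := hD y hy
  obtain ⟨w, hw, hxw⟩ := hD x hx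
  obtain ⟨s, hs, hs1⟩ := exists_tendsto_sum_b hd hk hz hw
  -- Between the two eigenvectors the defect sum acts as the scalar `s`, so the squared defect acts
  -- as `1 - s`, the reciprocal of the kernel at `(z, w)`.
  have hS : inner ℂ y (hB.exists_sum.choose x) = s * inner ℂ y x := by
    have h1 := (tendsto_const_nhds (x := y)).inner (hB.exists_sum.choose_spec.2 x) (𝕜 := ℂ)
    refine tendsto_nhds_unique h1 ((hs.mul_const (inner ℂ y x)).congr fun N => ?_)
    have h2 := inner_sum_tuplePow_adjoint hB.commute hyz hxw 1 ((degLE d N).erase 0)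
      fun α => (k.bM α : ℂ)
    simp only [one_apply_eq_self] at h2
    rw [h2, sum_degLE_bM]
  have hΔ : inner ℂ y ((defect hB ^ 2) x) = (1 - s) * inner ℂ y x := by
    rw [defect_sq, sub_apply, inner_sub_right, hS, one_apply_eq_self]
    ring
  have h1 := ((k.hasSum_aM hz hw).comp (tendsto_degLE d)).mul_const (inner ℂ y ((defect hB ^ 2) x))
  -- The purity series contributes the kernel value itself, and the two factors cancel.
  rw [hΔ, ← mul_assoc, hs1, one_mul] at h1
  refine h1.congr fun N => ?_
  rw [hP, inner_sum_tuplePow_adjoint hB.commute hyz hxw, hΔ]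
  rfl

end UnitarilyInvariantKernel

/-! ### The Drury–Arveson space and its backward shifts. -/

theorem hasSum_add_single_iff {d : ℕ} {X : Type*} [AddCommMonoid X] [TopologicalSpace X]
    (i : Fin d) {f : (Fin d → ℕ) → X} (hf : ∀ β, β i = 0 → f β = 0) {x : X} :
    HasSum (fun α : Fin d → ℕ => f (α + Pi.single i 1)) x ↔ HasSum f x := by
  have hinj : Function.Injective fun α : Fin d → ℕ => α + Pi.single i 1 := add_left_injective _
  refine hinj.hasSum_iff fun β hβ => hf β ?_
  by_contra h
  refine hβ ⟨β - Pi.single i 1, tsub_add_cancel_of_le fun j => ?_⟩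
  by_cases hj : j = i
  · subst hj; simpa using Nat.one_le_iff_ne_zero.2 h
  · simp [hj]

namespace UnitarilyInvariantKernel

open ContinuousLinearMap

/-- The Drury–Arveson kernel `1 / (1 - ⟨z, w⟩)`. -/
def druryArveson (d : ℕ) : UnitarilyInvariantKernel d where
  a _ := 1
  a_pos _ := one_pos
  a_zero := rfl
  summable z hz w hw := by
    simpa using summable_geometric_of_norm_lt_one (norm_inner_lt_one hz hw)
  ne_zero z hz w hw := by
    have h := norm_inner_lt_one hz hw
    simp only [Complex.ofReal_one, one_mul]
    rw [tsum_geometric_of_norm_lt_one h]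
    refine inv_ne_zero fun h0 => ?_
    rw [← sub_eq_zero.1 h0, norm_one] at h
    exact lt_irrefl _ h

variable {d : ℕ}

theorem druryArveson_aM (α : Fin d → ℕ) :
    (druryArveson d).aM α = Nat.multinomial Finset.univ α :=
  one_mul _

/-- Factorials give `(αᵢ + 1) · multinomial(α + eᵢ) = (|α| + 1) · multinomial(α)`. The resulting
ratios `βᵢ / |β|` sum to `1` over `i` when `β ≠ 0`, which makes the backward shifts jointly
contractive. -/
theorem druryArveson_shiftWeight_sq (i : Fin d) (α : Fin d → ℕ) :
    (druryArveson d).shiftWeight i α ^ 2 =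
      ((α + Pi.single i 1 : Fin d → ℕ) i : ℝ) /
        ((∑ j, (α + Pi.single i 1 : Fin d → ℕ) j : ℕ) : ℝ) := by
  have h1 := Nat.multinomial_spec Finset.univ α
  have h2 := Nat.multinomial_spec Finset.univ (α + Pi.single i 1)
  have hsum : ∑ j, (α + Pi.single i 1 : Fin d → ℕ) j = ∑ j, α j + 1 := by simp [Finset.sum_add_distrib]
  have hprod : ∏ j, Nat.factorial ((α + Pi.single i 1 : Fin d → ℕ) j) =
      (α i + 1) * ∏ j, Nat.factorial (α j) := by
    rw [← Finset.mul_prod_erase _ _ (Finset.mem_univ i),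
      ← Finset.mul_prod_erase _ (fun j => Nat.factorial (α j)) (Finset.mem_univ i), ← mul_assoc]
    congr 1
    · simp [Nat.factorial_succ]
    · refine Finset.prod_congr rfl fun j hj => ?_
      simp [Finset.ne_of_mem_erase hj]
  rw [hsum, hprod, Nat.factorial_succ, ← h1] at h2
  have hpos : 0 < ∏ j, Nat.factorial (α j) := Finset.prod_pos fun j _ => Nat.factorial_pos _
  have h3 : (α i + 1) * Nat.multinomial Finset.univ (α + Pi.single i 1) =
      (∑ j, α j + 1) * Nat.multinomial Finset.univ α :=
    Nat.eq_of_mul_eq_mul_left hpos (by linarith)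
  have hm : (0 : ℝ) < Nat.multinomial Finset.univ (α + Pi.single i 1) := by
    exact_mod_cast Nat.multinomial_pos _ _
  rw [shiftWeight, div_pow, Real.sq_sqrt (aM_pos _ _).le, Real.sq_sqrt (aM_pos _ _).le,
    druryArveson_aM, druryArveson_aM, hsum, div_eq_div_iff hm.ne' (by positivity)]
  have h4 : (α + Pi.single i 1 : Fin d → ℕ) i = α i + 1 := by simp
  rw [h4]
  have h5 : ((α i + 1 : ℕ) : ℝ) * Nat.multinomial Finset.univ (α + Pi.single i 1) =
      ((∑ j, α j + 1 : ℕ) : ℝ) * Nat.multinomial Finset.univ α := by exact_mod_cast h3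
  rw [h5, mul_comm]

section backwardShift

variable {E : Type*} [NormedAddCommGroup E] [InnerProductSpace ℂ E]

theorem multiIndex_ratio_le_one (i : Fin d) (β : Fin d → ℕ) :
    (β i : ℝ) / ((∑ j, β j : ℕ) : ℝ) ≤ 1 := by
  refine div_le_one_of_le₀ ?_ (Nat.cast_nonneg _)
  exact_mod_cast Finset.single_le_sum (fun j _ => Nat.zero_le (β j)) (Finset.mem_univ i)

theorem multiIndex_ratio_mul_le (i : Fin d) (β : Fin d → ℕ) (v : E) :
    (β i : ℝ) / ((∑ j, β j : ℕ) : ℝ) * ‖v‖ ^ 2 ≤ ‖v‖ ^ 2 :=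
  mul_le_of_le_one_left (by positivity) (multiIndex_ratio_le_one i β)

theorem summable_multiIndex_ratio (i : Fin d) (g : HSpace (druryArveson d) E) :
    Summable fun β => (β i : ℝ) / ((∑ j, β j : ℕ) : ℝ) * ‖coord g β‖ ^ 2 :=
  .of_nonneg_of_le (fun β => by positivity)
    (fun β => multiIndex_ratio_mul_le i β _) (hasSum_norm_coord g).summable

theorem hasSum_backwardShift (i : Fin d) (g : HSpace (druryArveson d) E) :
    HasSum (fun α => ‖((druryArveson d).shiftWeight i α : ℂ) • coord g (α + Pi.single i 1)‖ ^ 2)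
      (∑' β, (β i : ℝ) / ((∑ j, β j : ℕ) : ℝ) * ‖coord g β‖ ^ 2) := by
  have h := (hasSum_add_single_iff i (fun β hβ => by simp [hβ])).2
    (summable_multiIndex_ratio i g).hasSum
  refine h.congr_fun fun α => ?_
  rw [norm_smul, mul_pow, Complex.norm_of_nonneg (shiftWeight_nonneg _ _ _),
    druryArveson_shiftWeight_sq]

theorem tsum_multiIndex_ratio_le (i : Fin d) (g : HSpace (druryArveson d) E) :
    ∑' β, (β i : ℝ) / ((∑ j, β j : ℕ) : ℝ) * ‖coord g β‖ ^ 2 ≤ ‖g‖ ^ 2 :=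
  hasSum_le (fun β => multiIndex_ratio_mul_le i β _) (summable_multiIndex_ratio i g).hasSum
    (hasSum_norm_coord g)

theorem memℓp_backwardShift (i : Fin d) (g : HSpace (druryArveson d) E) :
    Memℓp (fun α => ((druryArveson d).shiftWeight i α : ℂ) • coord g (α + Pi.single i 1)) 2 :=
  memℓp_gen (by simpa using (hasSum_backwardShift i g).summable)

theorem norm_sq_backwardShift (i : Fin d) (g : HSpace (druryArveson d) E) :
    ‖ofCoord (druryArveson d) _ (memℓp_backwardShift i g)‖ ^ 2 =
      ∑' β, (β i : ℝ) / ((∑ j, β j : ℕ) : ℝ) * ‖coord g β‖ ^ 2 :=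
  (hasSum_norm_coord (ofCoord (druryArveson d) _ (memℓp_backwardShift i g))).unique
    (hasSum_backwardShift i g)

/-- The adjoint of the shift `M_{z_i}` on the Drury–Arveson space. -/
def backwardShift (i : Fin d) : HSpace (druryArveson d) E →L[ℂ] HSpace (druryArveson d) E :=
  LinearMap.mkContinuous
    { toFun := fun g => ofCoord _ _ (memℓp_backwardShift i g)
      map_add' := fun f g => coord_ext fun α => by
        simp only [coord_add, coord_ofCoord, smul_add]
      map_smul' := fun c f => coord_ext fun α => by
        simp only [coord_smul, coord_ofCoord, smul_comm c, RingHom.id_apply] }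
    1 fun g => by
      rw [one_mul]
      exact le_of_sq_le_sq ((norm_sq_backwardShift i g).trans_le (tsum_multiIndex_ratio_le i g))
        (norm_nonneg _)

theorem coord_backwardShift (i : Fin d) (g : HSpace (druryArveson d) E) (α : Fin d → ℕ) :
    coord (backwardShift i g) α =
      ((druryArveson d).shiftWeight i α : ℂ) • coord g (α + Pi.single i 1) := rfl

theorem sum_multiIndex_ratio (β : Fin d → ℕ) :
    ∑ i, (β i : ℝ) / ((∑ j, β j : ℕ) : ℝ) = if β = 0 then 0 else 1 := by
  rw [← Finset.sum_div, ← Nat.cast_sum]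
  -- For `β = 0` every quotient is `0 / 0`, which is `0` by convention.
  by_cases h : β = 0
  · simp [h]
  · rw [if_neg h, div_self]
    intro h0
    refine h (funext fun i => ?_)
    exact Finset.sum_eq_zero_iff.1 (by exact_mod_cast h0) i (Finset.mem_univ i)

theorem sum_norm_backwardShift_sq_le (g : HSpace (druryArveson d) E) :
    ∑ i, ‖backwardShift i g‖ ^ 2 ≤ ‖g‖ ^ 2 := by
  have h1 : ∀ i, ‖backwardShift i g‖ ^ 2 =
      ∑' β, (β i : ℝ) / ((∑ j, β j : ℕ) : ℝ) * ‖coord g β‖ ^ 2 := fun i =>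
    norm_sq_backwardShift i g
  simp only [h1]
  refine hasSum_le (fun β => ?_) (hasSum_sum fun i _ => (summable_multiIndex_ratio i g).hasSum)
    (hasSum_norm_coord g)
  rw [← Finset.sum_mul, sum_multiIndex_ratio]
  refine mul_le_of_le_one_left (by positivity) ?_
  split_ifs <;> norm_num

/-- The operator `∑ zᵢ Rᵢ`, where the `Rᵢ` are the backward shifts. -/
def backwardPencil (E : Type*) [NormedAddCommGroup E] [InnerProductSpace ℂ E]
    (z : EuclideanSpace ℂ (Fin d)) : HSpace (druryArveson d) E →L[ℂ] HSpace (druryArveson d) E :=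
  ∑ i, z i • backwardShift i

/-- Cauchy–Schwarz over `i`, combined with the column contraction property of the backward shifts.
-/
theorem norm_backwardPencil_le (z : EuclideanSpace ℂ (Fin d)) :
    ‖backwardPencil E z‖ ≤ ‖z‖ := by
  refine opNorm_le_bound _ (norm_nonneg z) fun g => le_of_sq_le_sq ?_ (by positivity)
  have h1 : ‖backwardPencil E z g‖ ≤ ∑ i, ‖z i‖ * ‖backwardShift i g‖ := by
    rw [backwardPencil, sum_apply]
    refine (norm_sum_le _ _).trans_eq ?_
    simp [norm_smul]
  calc _ ≤ (∑ i, ‖z i‖ * ‖backwardShift i g‖) ^ 2 := by gcongr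
    _ ≤ (∑ i, ‖z i‖ ^ 2) * ∑ i, ‖backwardShift i g‖ ^ 2 := Finset.sum_mul_sq_le_sq_mul_sq _ _ _
    _ ≤ ‖z‖ ^ 2 * ‖g‖ ^ 2 := by
        rw [EuclideanSpace.norm_sq_eq]
        gcongr
        exact sum_norm_backwardShift_sq_le g
    _ = _ := (mul_pow _ _ _).symm

variable [CompleteSpace E]

/-- The identity `g(z) - g(0) = ∑ zᵢ (Rᵢ g)(z)`: the `i`-th summand contributes the fraction `βᵢ /
|β|` of the term of index `β`, and these fractions add up to one except at `β = 0`. -/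
theorem backwardPencil_apply (z : cball d) (g : HSpace (druryArveson d) E) :
    evalCLM _ z (backwardPencil E z.1 g) = evalCLM _ z g - coord g 0 := by
  have h1 : ∀ i, HasSum (fun β : Fin d → ℕ => (((β i : ℝ) / ((∑ j, β j : ℕ) : ℝ) : ℝ) : ℂ) •
      (druryArveson d).basisVal z.1 β • coord g β) (z.1 i • evalCLM _ z (backwardShift i g)) := by
    intro i
    refine (hasSum_add_single_iff i fun β hβ => by simp [hβ]).1 ?_
    refine ((hasSum_evalCLM _ z (backwardShift i g)).const_smul (z.1 i)).congr_fun fun α => ?_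
    rw [← druryArveson_shiftWeight_sq, coord_backwardShift, smul_smul, smul_smul, smul_smul,
      ← shiftWeight_basisVal]
    congr 1
    push_cast
    ring
  have h2 : HasSum (fun β : Fin d → ℕ =>
      (druryArveson d).basisVal z.1 β • coord g β - if β = 0 then coord g 0 else 0)
      (evalCLM _ z g - coord g 0) :=
    (hasSum_evalCLM _ z g).sub (hasSum_ite_eq 0 (coord g 0))
  have h3 := hasSum_sum (s := Finset.univ) fun i _ => h1 i
  have h4 : evalCLM _ z (backwardPencil E z.1 g) =
      ∑ i, z.1 i • evalCLM _ z (backwardShift i g) := by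
    simp [backwardPencil, sum_apply]
  rw [h4]
  refine h3.unique (h2.congr_fun fun β => ?_)
  rw [← Finset.sum_smul, ← Complex.ofReal_sum, sum_multiIndex_ratio]
  by_cases h : β = 0
  · subst h
    simp [basisVal_zero]
  · simp [h]

end backwardShift

/-! ### Analyticity of point evaluation in operator norm. -/

section analytic

variable (k : UnitarilyInvariantKernel d) (E : Type*) [NormedAddCommGroup E]
  [InnerProductSpace ℂ E] [CompleteSpace E]

open scoped Classical in
/-- Evaluation at a point of the ball, extended by zero. -/
def evalExt (z : EuclideanSpace ℂ (Fin d)) : HSpace k E →L[ℂ] E :=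
  if h : z ∈ cball d then k.evalCLM ⟨z, h⟩ else 0

theorem evalExt_of_mem {z : EuclideanSpace ℂ (Fin d)} (hz : z ∈ cball d) :
    k.evalExt E z = k.evalCLM ⟨z, hz⟩ := dif_pos hz

/-- By `backwardPencil_apply`, evaluation at `z` composed with `I - ∑ zᵢ Rᵢ` is the constant
coefficient. The pencil has norm below `1` on the ball, so evaluation is the constant coefficient
composed with the inverse of `I - ∑ zᵢ Rᵢ`. -/
theorem analyticOnNhd_evalExt_druryArveson :
    AnalyticOnNhd ℂ ((druryArveson d).evalExt E) (cball d) := by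
  intro z₀ hz₀
  have hlt : ∀ z ∈ cball d, ‖backwardPencil E z‖ < 1 := fun z hz =>
    (norm_backwardPencil_le z).trans_lt (by simpa using hz)
  have hN : AnalyticAt ℂ (fun z : EuclideanSpace ℂ (Fin d) => 1 - backwardPencil E z) z₀ := by
    refine analyticAt_const.sub ?_
    change AnalyticAt ℂ (fun z : EuclideanSpace ℂ (Fin d) =>
      ∑ i, z i • backwardShift (E := E) i) z₀
    refine Finset.analyticAt_fun_sum _ fun i _ => ?_
    exact ((EuclideanSpace.proj i : EuclideanSpace ℂ (Fin d) →L[ℂ] ℂ).analyticAt z₀).smul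
      analyticAt_const
  have hinv : AnalyticAt ℂ
      (fun z : EuclideanSpace ℂ (Fin d) => Ring.inverse (1 - backwardPencil E z)) z₀ :=
    AnalyticAt.comp (g := Ring.inverse)
      (analyticAt_inverse (𝕜 := ℂ) (Units.oneSub (backwardPencil E z₀) (hlt z₀ hz₀))) hN
  have hcomp := ((compL ℂ (HSpace (druryArveson d) E) (HSpace (druryArveson d) E) E
    ((druryArveson d).coordCLM 0)).analyticAt _).comp hinv
  refine hcomp.congr ?_
  filter_upwards [Metric.isOpen_ball.mem_nhds hz₀] with z hz
  have h1 : (druryArveson d).evalCLM ⟨z, hz⟩ ∘L (1 - backwardPencil E z) =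
      (druryArveson d).coordCLM 0 := by
    ext g
    have := backwardPencil_apply ⟨z, hz⟩ g
    simp [this, coordCLM_apply]
  have hu : IsUnit (1 - backwardPencil E z) := (Units.oneSub _ (hlt z hz)).isUnit
  change (druryArveson d).coordCLM 0 ∘L Ring.inverse (1 - backwardPencil E z) = _
  rw [evalExt_of_mem _ _ hz, ← h1, comp_assoc, ← mul_def, Ring.mul_inverse_cancel _ hu]
  rfl

/-- For `‖z‖ < r < 1`, evaluation on `H_k(E)` factors as a fixed diagonal map `D` into the
Drury–Arveson space followed by evaluation at `z / r`. The entries `√aₙ rⁿ` of `D` supply the kernel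
coefficients and undo the dilation. -/
theorem analyticOnNhd_evalExt (hd : 1 ≤ d) : AnalyticOnNhd ℂ (k.evalExt E) (cball d) := by
  intro z₀ hz₀
  obtain ⟨r, hr, hr1⟩ := exists_between (mem_ball_zero_iff.1 hz₀)
  have hr0 : 0 < r := (norm_nonneg _).trans_lt hr
  obtain ⟨C, hC0, hC⟩ : ∃ C : ℝ, 0 ≤ C ∧ ∀ n, √(k.a n) * r ^ n ≤ C := by
    -- Convergence of `∑ aₙ tⁿ` at `t = r²` bounds the squares of the entries.
    have ht : ‖((r ^ 2 : ℝ) : ℂ)‖ < 1 := by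
      rw [Complex.norm_of_nonneg (by positivity)]
      exact pow_lt_one₀ hr0.le hr1 two_ne_zero
    obtain ⟨C, hC⟩ := (summable_norm_a (k := k) hd ht).tendsto_atTop_zero.bddAbove_range
    refine ⟨√C, Real.sqrt_nonneg _, fun n => Real.le_sqrt_of_sq_le ?_⟩
    have := hC ⟨n, rfl⟩
    simp only [norm_mul, norm_pow, Complex.norm_of_nonneg (k.a_pos n).le,
      Complex.norm_of_nonneg (sq_nonneg r)] at this
    rwa [mul_pow, Real.sq_sqrt (k.a_pos n).le, ← pow_mul, mul_comm n, pow_mul]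
  have hσ : ∀ β : Fin d → ℕ, ‖((√(k.a (∑ i, β i)) * r ^ (∑ i, β i) : ℝ) : ℂ)‖ ≤ C := fun β => by
    rw [Complex.norm_of_nonneg (by positivity)]
    exact hC _
  let D : HSpace k E →L[ℂ] HSpace (druryArveson d) E := diagonal k (druryArveson d) _ hC0 hσ
  have hmem : ∀ z ∈ Metric.ball (0 : EuclideanSpace ℂ (Fin d)) r, (r⁻¹ : ℂ) • z ∈ cball d := by
    intro z hz
    rw [mem_ball_zero_iff] at hz ⊢
    rw [norm_smul, norm_inv, Complex.norm_of_nonneg hr0.le, inv_mul_lt_one₀ hr0]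
    exact hz
  have hz₀r : z₀ ∈ Metric.ball (0 : EuclideanSpace ℂ (Fin d)) r := mem_ball_zero_iff.2 hr
  have h1 : AnalyticAt ℂ (fun z : EuclideanSpace ℂ (Fin d) =>
      (druryArveson d).evalExt E ((r⁻¹ : ℂ) • z)) z₀ :=
    (analyticOnNhd_evalExt_druryArveson E _ (hmem z₀ hz₀r)).comp_of_eq
      (((r⁻¹ : ℂ) • ContinuousLinearMap.id ℂ (EuclideanSpace ℂ (Fin d))).analyticAt z₀) rfl
  have h2 := (((compL ℂ (HSpace k E) (HSpace (druryArveson d) E) E).flip D).analyticAt _).comp h1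
  refine h2.congr ?_
  filter_upwards [Metric.isOpen_ball.mem_nhds hz₀r] with z hz
  have hzb : z ∈ cball d := Metric.ball_subset_ball hr1.le hz
  change (druryArveson d).evalExt E ((r⁻¹ : ℂ) • z) ∘L D = _
  rw [evalExt_of_mem _ _ (hmem z hz), evalExt_of_mem _ _ hzb]
  ext f
  refine (hasSum_evalCLM _ _ (D f)).unique ((hasSum_evalCLM k ⟨z, hzb⟩ f).congr_fun fun β => ?_)
  rw [coord_diagonal, smul_smul]
  congr 1
  have hmon : monom β ((r⁻¹ : ℂ) • z) = (r⁻¹ : ℂ) ^ (∑ i, β i) * monom β z := by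
    simp [monom, mul_pow, Finset.prod_mul_distrib, Finset.prod_pow_eq_pow_sum]
  have hr' : (r : ℂ) ≠ 0 := by exact_mod_cast hr0.ne'
  rw [basisVal, basisVal, hmon, druryArveson_aM, aM, Real.sqrt_mul (k.a_pos _).le]
  push_cast
  rw [inv_pow]
  field_simp

end analytic

end UnitarilyInvariantKernel

/-! ### Intertwining coisometries and multipliers. -/

namespace UnitarilyInvariantKernel

open ContinuousLinearMap

variable {d : ℕ} {k l : UnitarilyInvariantKernel d}

/-- If a coisometry intertwines a `1/k`-contraction with a commuting tuple, then the latter is a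
`1/k`-contraction. -/
theorem IsContraction.of_coisometry {H K : Type*} [NormedAddCommGroup H] [InnerProductSpace ℂ H]
    [CompleteSpace H] [NormedAddCommGroup K] [InnerProductSpace ℂ K] [CompleteSpace K]
    {T : Fin d → H →L[ℂ] H} {B : Fin d → K →L[ℂ] K} (hT : k.IsContraction T)
    (hB : ∀ i j, Commute (B i) (B j)) {N : H →L[ℂ] K} (hN : ∀ i, N ∘L T i = B i ∘L N)
    (hco : N ∘L adjoint N = 1) : k.IsContraction B := by
  obtain ⟨S, hS1, hS⟩ := hT.exists_sum
  have hnorm : ‖adjoint N‖ ≤ 1 := by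
    refine opNorm_le_bound _ zero_le_one fun x => ?_
    refine le_of_sq_le_sq ?_ (by positivity)
    rw [one_mul, ← inner_self_eq_norm_sq (𝕜 := ℂ), adjoint_inner_right,
      ← comp_apply N (adjoint N), hco, one_apply_eq_self, inner_self_eq_norm_sq]
  have hnorm' : ‖N‖ ≤ 1 := by rwa [LinearIsometryEquiv.norm_map] at hnorm
  refine ⟨hB, N ∘L S ∘L adjoint N, ?_, fun x => ?_⟩
  · refine (opNorm_comp_le _ _).trans (mul_le_one₀ hnorm' (norm_nonneg _) ?_)
    exact (opNorm_comp_le _ _).trans (mul_le_one₀ hS1 (norm_nonneg _) hnorm)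
  · refine ((N.continuous.tendsto _).comp (hS (adjoint N x))).congr fun n => ?_
    rw [Function.comp_apply, map_sum]
    refine Finset.sum_congr rfl fun α _ => ?_
    have h1 := comp_tuplePow hT.commute hB hN α
    -- The adjoint of the intertwining relation; with `N N* = I` it yields `N T^α (T^α)* N* = B^α
    -- (B^α)*`, so the series compresses term by term.
    have h2 : adjoint (tuplePow T α) (adjoint N x) = adjoint N (adjoint (tuplePow B α) x) := by
      rw [← comp_apply, ← adjoint_comp, h1, adjoint_comp, comp_apply]
    rw [map_smul, h2, ← comp_apply N (tuplePow T α), h1, comp_apply, ← comp_apply N (adjoint N),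
      hco, one_apply_eq_self]

section multiplier

variable (hl : l.Admissible) (hk : k.Admissible) {E F : Type*} [NormedAddCommGroup E]
  [InnerProductSpace ℂ E] [CompleteSpace E] [NormedAddCommGroup F] [InnerProductSpace ℂ F]
  [CompleteSpace F]

theorem IsMulOperator.comp_coordMul {θ : EuclideanSpace ℂ (Fin d) → E →L[ℂ] F}
    {M : HSpace l E →L[ℂ] HSpace k F} (hM : IsMulOperator θ M) (i : Fin d) :
    M ∘L coordMul hl E i = coordMul hk F i ∘L M := by
  ext1 f
  refine RKHS.ext fun z => ?_
  rw [comp_apply, comp_apply, coordMul_apply, hM, hM, coordMul_apply, map_smul]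

variable (l E) in
/-- The inclusion of `E` into `H_l(E)` as constant functions. -/
def constCLM : E →L[ℂ] HSpace l E :=
  LinearMap.mkContinuous
    { toFun := fun v => l.basisFun 0 v
      map_add' := fun v w => RKHS.ext fun z => by
        rw [RKHS.coe_add, Pi.add_apply, basisFun_apply, basisFun_apply, basisFun_apply, smul_add]
      map_smul' := fun c v => RKHS.ext fun z => by
        rw [RKHS.coe_smul, Pi.smul_apply, basisFun_apply, basisFun_apply, smul_comm,
          RingHom.id_apply] }
    1 fun v => by
      rw [one_mul]
      exact (norm_basisFun l 0 v).le

theorem constCLM_apply (v : E) : constCLM l E v = l.basisFun 0 v := rfl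

/-- Constants generate the basis under the shifts, so an intertwining operator is determined by its
values on constants. -/
theorem basisFun_eq_smul_tuplePow (β : Fin d → ℕ) (v : E) :
    l.basisFun β v = ((√(l.aM β) : ℝ) : ℂ) • tuplePow (coordMul hl E) β (constCLM l E v) := by
  refine RKHS.ext fun z => ?_
  rw [RKHS.coe_smul, Pi.smul_apply, tuplePow_coordMul_apply, constCLM_apply, basisFun_apply,
    basisFun_apply, basisVal_zero, one_smul, smul_smul, basisVal]

/-- A bounded operator that intertwines the shifts is multiplication by an analytic function. -/
theorem exists_isMulOperator (hd : 1 ≤ d) {M : HSpace l E →L[ℂ] HSpace k F}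
    (hM : ∀ i, M ∘L coordMul hl E i = coordMul hk F i ∘L M) :
    ∃ θ : EuclideanSpace ℂ (Fin d) → E →L[ℂ] F,
      AnalyticOnNhd ℂ θ (cball d) ∧ IsMulOperator θ M := by
  -- `θ(z) v` is the value at `z` of the image of the constant function `v`.
  refine ⟨fun z => k.evalExt F z ∘L (M ∘L constCLM l E), fun z hz => ?_, fun f z => ?_⟩
  · exact (((compL ℂ E (HSpace k F) F).flip (M ∘L constCLM l E)).analyticAt _).comp
      (analyticOnNhd_evalExt k F hd z hz)
  · beta_reduce
    rw [evalExt_of_mem _ _ z.2]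
    have h1 := ((k.evalCLM z).comp M).hasSum (l.hasSum_basisFun f)
    have h2 := (k.evalCLM z ∘L (M ∘L constCLM l E)).hasSum (l.hasSum_apply f z)
    refine h1.unique (h2.congr_fun fun β => ?_)
    have h3 : M (tuplePow (coordMul hl E) β (constCLM l E (coord f β))) =
        tuplePow (coordMul hk F) β (M (constCLM l E (coord f β))) := by
      rw [← comp_apply, comp_tuplePow (commute_coordMul hl E) (commute_coordMul hk F) hM,
        comp_apply]
    have h4 : k.evalCLM z (tuplePow (coordMul hk F) β (M (constCLM l E (coord f β)))) =
        monom β z.1 • k.evalCLM z (M (constCLM l E (coord f β))) :=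
      tuplePow_coordMul_apply hk β _ z
    rw [comp_apply, basisFun_eq_smul_tuplePow hl, map_smul, map_smul, h3, h4, map_smul, smul_smul]
    rfl

end multiplier

/-! ### The associated tuple and the two implications. -/

section model

variable {H : Type u} [NormedAddCommGroup H] [InnerProductSpace ℂ H] [CompleteSpace H]
  {T : Fin d → H →L[ℂ] H}

theorem modelAdjoint_modelIsometry (hT : k.IsPure T) (h : H) :
    modelAdjoint hT (modelIsometry hT h) = h := by
  have : modelAdjoint hT ∘L (modelIsometry hT).toContinuousLinearMap = 1 :=
    (norm_map_iff_adjoint_comp_self _).1 (modelIsometry hT).norm_map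
  exact congr($this h)

/-- A pure `1/k`-contraction is the image of some `M_z ⊗ I_E` under a coisometry. -/
theorem IsPure.exists_coisometry (hk : k.Admissible) (hT : k.IsPure T) :
    ∃ (E : Type u) (_ : NormedAddCommGroup E) (_ : InnerProductSpace ℂ E) (_ : CompleteSpace E)
      (N : HSpace k E →L[ℂ] H), (∀ i, N ∘L coordMul hk E i = T i ∘L N) ∧ N ∘L adjoint N = 1 := by
  refine ⟨defectSpace hT.isContraction, inferInstance, inferInstance, inferInstance,
    modelAdjoint hT, fun i => ?_, ?_⟩
  · ext1 f
    exact modelAdjoint_coordMul hk hT i f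
  · ext1 h
    rw [comp_apply, modelAdjoint, adjoint_adjoint]
    exact modelAdjoint_modelIsometry hT h

theorem sub_modelIsometry_mem_modelKer (hT : k.IsPure T)
    (f : HSpace k (defectSpace hT.isContraction)) :
    f - modelIsometry hT (modelAdjoint hT f) ∈ modelKer hT := by
  change modelAdjoint hT _ = 0
  rw [map_sub, modelAdjoint_modelIsometry, sub_self]

/-- The projection onto `Ker V_T^*` is `I - V_T V_T^*`. -/
theorem adjoint_subtypeL_modelKer (hT : k.IsPure T)
    (f : HSpace k (defectSpace hT.isContraction)) :
    ((adjoint (modelKer hT).subtypeL f : modelKer hT) :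
      HSpace k (defectSpace hT.isContraction)) = f - modelIsometry hT (modelAdjoint hT f) := by
  have : adjoint (modelKer hT).subtypeL f = ⟨_, sub_modelIsometry_mem_modelKer hT f⟩ := by
    refine ext_inner_left ℂ fun y => ?_
    have hy : modelAdjoint hT y = 0 := y.2
    rw [adjoint_inner_right, Submodule.coe_inner]
    change _ = inner ℂ (y : HSpace k (defectSpace hT.isContraction)) _
    rw [inner_sub_right]
    have h1 : inner ℂ (y : HSpace k (defectSpace hT.isContraction))
        (modelIsometry hT (modelAdjoint hT f)) = inner ℂ (modelAdjoint hT y) (modelAdjoint hT f) :=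
      (adjoint_inner_left (modelIsometry hT).toContinuousLinearMap _ _).symm
    rw [h1, hy, inner_zero_left, sub_zero]
    rfl
  rw [this]

theorem commute_assocTuple (hk : k.Admissible) (hT : k.IsPure T) (i j : Fin d) :
    Commute (assocTuple hk hT i) (assocTuple hk hT j) := by
  ext1 f
  refine Subtype.ext ?_
  exact congr($(commute_coordMul hk _ i j) (f : HSpace k (defectSpace hT.isContraction)))

/-- If `B_T` is a `1/l`-contraction, then it is pure. -/
theorem isPure_assocTuple (hd : 1 ≤ d) (hk : k.Admissible) (hl : l.Admissible) (hT : k.IsPure T)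
    (hB : l.IsContraction (assocTuple hk hT)) : l.IsPure (assocTuple hk hT) := by
  let J := (modelKer hT).subtypeL
  let D : Set (modelKer hT) := {x | ∃ (z : cball d) (v : defectSpace hT.isContraction),
    x = adjoint J (RKHS.kerFun (HSpace k (defectSpace hT.isContraction)) z v)}
  refine hB.isPure hd hl (D := D) ?_ ?_
  -- A vector of the kernel space orthogonal to all projected kernel functions vanishes as a
  -- function, by the reproducing property.
  · rw [Submodule.topologicalClosure_eq_top_iff, Submodule.eq_bot_iff]
    intro y hy
    refine Subtype.ext (RKHS.ext fun z => ?_)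
    refine ext_inner_left ℂ fun v => ?_
    have h1 := (Submodule.mem_orthogonal _ _).1 hy _ (Submodule.subset_span ⟨z, v, rfl⟩)
    rw [adjoint_inner_left, RKHS.kerFun_inner] at h1
    rw [Submodule.coe_zero, RKHS.coe_zero, Pi.zero_apply, inner_zero_right]
    exact h1
  · rintro x ⟨z, v, rfl⟩
    refine ⟨z.1, z.2, fun i => ext_inner_right ℂ fun y => ?_⟩
    rw [adjoint_inner_left, adjoint_inner_left, inner_smul_left, adjoint_inner_left,
      RKHS.kerFun_inner, RKHS.kerFun_inner]
    change inner ℂ v (coordMul hk _ i (y : HSpace k (defectSpace hT.isContraction)) z) = _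
    rw [coordMul_apply, inner_smul_right]
    simp [J]

/-- The multiplication operator, viewed as a map into `Ker V*`, is a coisometry intertwining the
`l`-shifts with the associated tuple. -/
theorem isContraction_assocTuple (hk : k.Admissible) (hl : l.Admissible) (hT : k.IsPure T)
    (h : AdmitsCharacteristicFunction l hT) : l.IsContraction (assocTuple hk hT) := by
  obtain ⟨E, _, _, _, θ, M, -, hM, hVM⟩ := h
  have hMM : ∀ f, M (adjoint M f) = f - modelIsometry hT (modelAdjoint hT f) := fun f =>
    (congr($hVM f)).symm
  -- With `X = V* M`, one has `X X* = V* (I - V V*) V = 0`, hence `X* = 0`.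
  have hker : modelAdjoint hT ∘L M = 0 := by
    have h1 : adjoint (modelAdjoint hT ∘L M) = 0 := by
      ext1 x
      rw [zero_apply, ← norm_eq_zero, ← sq_eq_zero_iff, ← inner_self_eq_norm_sq (𝕜 := ℂ),
        adjoint_inner_right, comp_apply, adjoint_comp, comp_apply, hMM, map_sub,
        modelAdjoint_modelIsometry, sub_self, inner_zero_left, map_zero]
    rw [← adjoint_adjoint (modelAdjoint hT ∘L M), h1, map_zero]
  let N : HSpace l E →L[ℂ] modelKer hT := M.codRestrict (modelKer hT) fun f => congr($hker f)
  have hJN : (modelKer hT).subtypeL ∘L N = M := rfl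
  refine (isContraction_coordMul hl E).of_coisometry (commute_assocTuple hk hT) (N := N)
    (fun i => ?_) ?_
  · ext1 f
    exact Subtype.ext congr($(hM.comp_coordMul hl hk i) f)
  · ext1 x
    refine Subtype.ext ?_
    have h1 : adjoint N x = adjoint M x := by
      refine ext_inner_right ℂ fun f => ?_
      rw [adjoint_inner_left, adjoint_inner_left]
      rfl
    have hx : modelAdjoint hT x = 0 := x.2
    change M (adjoint N x) = x
    rw [h1, hMM, hx, map_zero, sub_zero]

/-- Purity of the associated tuple supplies its own model over `l`, hence a coisometry `N` onto `Ker
V*`. Following it by the inclusion `J` keeps the intertwining with the shifts and gives `J N N* J* =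
J J* = I - V V*`. -/
theorem admitsCharacteristicFunction (hd : 1 ≤ d) (hk : k.Admissible) (hl : l.Admissible)
    (hT : k.IsPure T) (hB : l.IsContraction (assocTuple hk hT)) :
    AdmitsCharacteristicFunction l hT := by
  obtain ⟨E, _, _, _, N, hN, hco⟩ := (isPure_assocTuple hd hk hl hT hB).exists_coisometry hl
  let J := (modelKer hT).subtypeL
  have hM : ∀ i, (J ∘L N) ∘L coordMul hl E i = coordMul hk _ i ∘L (J ∘L N) := fun i => by
    ext1 f
    exact congr(J ($(hN i) f))
  obtain ⟨θ, hθ, hθM⟩ := exists_isMulOperator hl hk hd hM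
  refine ⟨E, inferInstance, inferInstance, inferInstance, θ, J ∘L N, hθ, hθM, ?_⟩
  ext1 f
  rw [adjoint_comp]
  change f - modelIsometry hT (modelAdjoint hT f) = J (N (adjoint N (adjoint J f)))
  rw [← comp_apply N, hco]
  exact (adjoint_subtypeL_modelKer hT f).symm

end model

end UnitarilyInvariantKernel

end

/-- A pure `1/k`-contraction admits a characteristic function through `l` if and only if its
associated tuple is a `1/l`-contraction. -/
theorem mainTheorem3 {d : ℕ} (hd : 1 ≤ d) (k l : UnitarilyInvariantKernel d)
    (hk : k.Admissible) (hl : l.Admissible)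
    {H : Type*} [NormedAddCommGroup H] [InnerProductSpace ℂ H] [CompleteSpace H]
    (T : Fin d → H →L[ℂ] H) (hT : k.IsPure T) :
    UnitarilyInvariantKernel.AdmitsCharacteristicFunction l hT ↔ l.IsContraction (UnitarilyInvariantKernel.assocTuple hk hT) :=
  ⟨UnitarilyInvariantKernel.isContraction_assocTuple hk hl hT,
    UnitarilyInvariantKernel.admitsCharacteristicFunction hd hk hl hT⟩
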